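/- **DRC-restriction semigroups.** A *DRC-restriction semigroup* is a non-empty set $S$ with an associative product and two unary operations ${}^+,{}^*$ such that for all $x,y\in S$ $$x^+x=x,\quad (xy)^+=(xy^+)^+,\quad (xy)^+=x^+(xy)^+x^+,\quad x^{++}=x^+,\quad x^{+*}=x^+,\quad x(yx)^*=(yx^+)^*x,$$ $$xx^*=x,\quad (xy)^*=(x^*y)^*,\quad (xy)^*=y^*(xy)^*y^*,\quad x^{**}=x^*,\quad x^{*+}=x^*,\quad (xy)^+x=x(x^*y)^+.$$ A *(2,1,1)-homomorphism* is a map preserving the product, ${}^+$ and ${}^*$. Put $P(S)=\{x^+\mid x\in S\}=\{x^*\mid x\in S\}$. **Strong projection algebras.** A *strong projection algebra* is a non-empty set $P$ with binary operations $\times,\star$ such that for all $e,f,g\in P$: $e\times e=e$; $(e\times f)\times e=e\times f$; $e\times(f\times g)=(e\times f)\times(f\times g)$; $(e\times f)\times g=(e\times f)\times(e\times g)$; $e\star e=e$; $f\star e=e\star(f\star e)$; $(g\star f)\star e=(g\star f)\star(f\star e)$; $g\star(f\star e)=(g\star e)\star(f\star e)$; $(e\star(f\times g))\star g=(e\star f)\star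 g$; $g\times((g\star f)\times e)=g\times(f\times e)$; $(e\times f)\star e=e\times f$; $f\times(e\star f)=e\star f$; $e\times(((e\times f)\times g)\star f)=(e\times f)\times g$; $(f\times(g\star(f\star e)))\star e=g\star(f\star e)$. Write $e\le_P f$ if $e=f\times e$, and $p\,\mathcal F_P\,q$ if $p\times q=p$ and $p\star q=q$. A *$P$-path* is a tuple $\mathfrak p=(p_1,\dots,p_k)$, $k\ge 1$, of elements of $P$ with $p_1\mathcal F_P p_2\mathcal F_P\cdots\mathcal F_P p_k$; put $d(\mathfrak p)=p_1$, $r(\mathfrak p)=p_k$ and, if $p_k=q_1$, $(p_1,\dots,p_k)\circ(q_1,\dots,q_l)=(p_1,\dots,p_k,q_2,\dots,q_l)$. Let $\mathscr P(P)$ be the set of $P$-paths. Write $\mathfrak p\le_{\mathscr P}\mathfrak q=(q_1,\dots,q_k)$ if $\mathfrak p=(r_1,\dots,r_k)$ with $r_1\le_P q_1$ and $r_i=r_{i-1}\star q_i$ for $2\le i\le k$. **Chain projection ordered categories.** Consider a small category given as a non-empty set $C$ (of arrows) with maps $d,r:C\to C$ and a partial product $\circ$, where $a\circ b$ is defined iff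 $r(a)=d(b)$, and then $d(a\circ b)=d(a)$, $r(a\circ b)=r(b)$; the product is associative when defined, and $d(a)\circ a$, $a\circ r(a)$ are defined and equal to $a$. Its set of objects is $P_C=\{d(a)\mid a\in C\}=\{r(a)\mid a\in C\}$. It is an *ordered category* with respect to a partial order $\le$ on $C$ if: $a\le b$ implies $d(a)\le d(b)$ and $r(a)\le r(b)$; if $a\le b$, $c\le e$ and $a\circ c$, $b\circ e$ are defined, then $a\circ c\le b\circ e$; for $p\in P_C$ with $p\le d(a)$ there is a unique ${}_p{\downharpoonleft}a\le a$ with $d({}_p{\downharpoonleft}a)=p$; for $q\in P_C$ with $q\le r(a)$ there is a unique $a{\downharpoonright}_q\le a$ with $r(a{\downharpoonright}_q)=q$. A *chain projection ordered category* $(C,\circ,d,r,\le,P_C,\times,\star,\varepsilon)$ is an ordered category together with binary operations $\times,\star$ on $P_C$ making it a strong projection algebra whose order $\le_{P_C}$ is the restriction of $\le$ to $P_C$, and a map $\varepsilon:\mathscr P(P_C)\to C$, subject to the following conditions. * Put $x\Theta_a=r({}_{x\star d(a)}{\downharpoonleft}a)$ and $x\Delta_a=d(a{\downharpoonright}_{r(a)\times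 x})$ for $a\in C$, $x\in P_C$. For all $a\in C$ and $p,x\in P_C$: $(p\Theta_a)\times x=(p\times(x\Delta_a))\Theta_a$ and $x\star(p\Delta_a)=((x\Theta_a)\star p)\Delta_a$. * $\varepsilon$ is an *evaluation map*: $\varepsilon(p)=\varepsilon(p,p)=p$ for $p\in P_C$; $d(\varepsilon(\mathfrak p))=d(\mathfrak p)$ and $r(\varepsilon(\mathfrak p))=r(\mathfrak p)$; $\varepsilon(\mathfrak p\circ\mathfrak q)=\varepsilon(\mathfrak p)\circ\varepsilon(\mathfrak q)$ whenever $\mathfrak p\circ\mathfrak q$ is defined; $\mathfrak p\le_{\mathscr P}\mathfrak q$ implies $\varepsilon(\mathfrak p)\le\varepsilon(\mathfrak q)$. * If $b\in C$ and $e,f\in P_C$ satisfy $f=(e\Theta_b)\star f$ and $e=e\times(f\Delta_b)$, then, with $e_1=e\star d(b)$, $f_1=e\Theta_b$, $e_2=f\Delta_b$, $f_2=r(b)\times f$ (all of the following being defined), $$\varepsilon(e,e_1)\circ{}_{e_1}{\downharpoonleft}b\circ\varepsilon(f_1,f)=\varepsilon(e,e_2)\circ b{\downharpoonright}_{f_2}\circ\varepsilon(f_2,f).$$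 A *chain projection ordered functor* $\phi:C_1\to C_2$ is a map that commutes with $d$ and $r$, preserves all products $a\circ b$ that are defined, preserves $\le$, restricts to a homomorphism for $\times$ and $\star$ from $P_{C_1}$ to $P_{C_2}$, and satisfies $\varepsilon_1(p_1,\dots,p_k)\phi=\varepsilon_2(p_1\phi,\dots,p_k\phi)$ for every path $(p_1,\dots,p_k)\in\mathscr P(P_{C_1})$. **Theorem.** The category of DRC-restriction semigroups with (2,1,1)-homomorphisms is isomorphic to the category of chain projection ordered categories with chain projection ordered functors. More precisely: 1. For a DRC-restriction semigroup $S$, let $\mathbf C(S)$ be the set $S$ with $d(a)=a^+$, $r(a)=a^*$; $a\circ b=ab$, defined iff $a^*=b^+$; $a\le b$ iff $a=a^+b$ and $b^+a^+b^+=a^+$; $e\times f=(ef)^+$ and $e\star f=(ef)^*$ for $e,f\in P(S)$; $\varepsilon(p_1,\dots,p_k)=p_1\cdots p_k$. Then $\mathbf C(S)$ is a chain projection ordered category, and every (2,1,1)-homomorphism $S\to T$ is a chain projection ordered functor $\mathbf C(S)\to\mathbf C(T)$. 2. For a chain projection ordered category $C$, let $\mathbf S(C)$ be the set $C$ with $a^+=d(a)$,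 $a^*=r(a)$ and $$a\bullet b=a{\downharpoonright}_{r(a)\times d(b)}\circ\varepsilon\bigl(r(a)\times d(b),\,r(a)\star d(b)\bigr)\circ{}_{r(a)\star d(b)}{\downharpoonleft}b .$$ Then $\mathbf S(C)$ is a DRC-restriction semigroup, and every chain projection ordered functor $C_1\to C_2$ is a (2,1,1)-homomorphism $\mathbf S(C_1)\to\mathbf S(C_2)$. 3. The functors $\mathbf C$ and $\mathbf S$ so obtained, which leave the underlying sets and maps unchanged, are mutually inverse: $\mathbf S(\mathbf C(S))=S$ and $\mathbf C(\mathbf S(C))=C$ for all $S$ and $C$. -/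

import Mathlib

open CategoryTheory

universe u v

namespace DRC

/-! ### DRC-restriction semigroups -/

/-- A carrier with a binary operation and two unary operations `x ↦ x⁺` and `x ↦ x*`. -/
class BiUnary (S : Type u) extends Mul S where
  plus : S → S
  ast : S → S

open BiUnary

/-- A DRC semigroup: an associative bi-unary algebra satisfying the DRC conditions. -/
structure IsDRCSemigroup (S : Type u) [BiUnary S] : Prop where
  mul_assoc : ∀ x y z : S, (x * y) * z = x * (y * z)
  plus_mul : ∀ x : S, plus x * x = x
  mul_ast : ∀ x : S, x * ast x = x
  plus_congr : ∀ x y : S, plus (x * y) = plus (x * plus y)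
  ast_congr : ∀ x y : S, ast (x * y) = ast (ast x * y)
  plus_reduced : ∀ x y : S, plus (x * y) = plus x * plus (x * y) * plus x
  ast_reduced : ∀ x y : S, ast (x * y) = ast y * ast (x * y) * ast y
  plus_plus : ∀ x : S, plus (plus x) = plus x
  ast_ast : ∀ x : S, ast (ast x) = ast x
  ast_plus : ∀ x : S, ast (plus x) = plus x
  plus_ast : ∀ x : S, plus (ast x) = ast x

/-- A DRC-restriction semigroup: a DRC semigroup satisfying the DRC-ample conditions. -/
structure IsDRCRestriction (S : Type u) [BiUnary S] : Prop extends IsDRCSemigroup S where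
  ample_left : ∀ x y : S, x * ast (y * x) = ast (y * plus x) * x
  ample_right : ∀ x y : S, plus (x * y) * x = x * plus (ast x * y)

/-- A (2,1,1)-homomorphism. -/
structure IsBiUnaryHom {S : Type u} {T : Type v} [BiUnary S] [BiUnary T] (φ : S → T) : Prop where
  map_mul : ∀ x y, φ (x * y) = φ x * φ y
  map_plus : ∀ x, φ (plus x) = plus (φ x)
  map_ast : ∀ x, φ (ast x) = ast (φ x)

/-- The objects of the category of (non-empty) DRC-restriction semigroups. -/
structure DRS : Type (u + 1) where
  carrier : Type u
  nonempty : Nonempty carrier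
  op : BiUnary carrier
  isDRCRestriction : @IsDRCRestriction carrier op

namespace DRS

instance (S : DRS.{u}) : BiUnary S.carrier := S.op

@[ext]
structure Hom (S T : DRS.{u}) : Type u where
  toFun : S.carrier → T.carrier
  isHom : IsBiUnaryHom toFun

instance : Category DRS.{u} where
  Hom S T := Hom S T
  id S := ⟨fun x => x, ⟨fun _ _ => rfl, fun _ => rfl, fun _ => rfl⟩⟩
  comp f g := ⟨fun x => g.toFun (f.toFun x),
    ⟨fun x y => by rw [f.isHom.map_mul, g.isHom.map_mul],
     fun x => by rw [f.isHom.map_plus, g.isHom.map_plus],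
     fun x => by rw [f.isHom.map_ast, g.isHom.map_ast]⟩⟩

end DRS

/-! ### Strong two-sided projection algebras and their paths -/

/-- A strong two-sided projection algebra `(P, ×, ⋆)`. -/
structure IsStrongProjAlg {P : Type u} (times star : P → P → P) : Prop where
  L1 : ∀ e, times e e = e
  L2 : ∀ e f, times (times e f) e = times e f
  L3 : ∀ e f g, times e (times f g) = times (times e f) (times f g)
  L4 : ∀ e f g, times (times e f) g = times (times e f) (times e g)
  R1 : ∀ e, star e e = e
  R2 : ∀ e f, star f e = star e (star f e)
  R3 : ∀ e f g, star (star g f) e = star (star g f) (star f e)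
  R4 : ∀ e f g, star g (star f e) = star (star g e) (star f e)
  P3_star : ∀ e f g, star (star e (times f g)) g = star (star e f) g
  P3_times : ∀ e f g, times g (times (star g f) e) = times g (times f e)
  P4_times : ∀ e f, star (times e f) e = times e f
  P4_star : ∀ e f, times f (star e f) = star e f
  SP1 : ∀ e f g, times e (star (times (times e f) g) f) = times (times e f) g
  SP2 : ∀ e f g, star (times f (star g (star f e))) e = star g (star f e)

/-- The partial order `e ≤_P f ↔ e = f × e` of a projection algebra. -/
def projLE {P : Type u} (times : P → P → P) (e f : P) : Prop := e = times f e

/-- The relation `p 𝓕 q ↔ p = p × q ∧ q = p ⋆ q`. -/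
def friendly {P : Type u} (times star : P → P → P) (p q : P) : Prop :=
  p = times p q ∧ q = star p q

/-- A `P`-path `(p₁, …, pₖ)`, `k ≥ 1`, with `p₁ 𝓕 p₂ 𝓕 ⋯ 𝓕 pₖ`; here `head = p₁` and
`tail = [p₂, …, pₖ]`. -/
@[ext]
structure PPath {P : Type u} (times star : P → P → P) : Type u where
  head : P
  tail : List P
  chain : List.IsChain (friendly times star) (head :: tail)

namespace PPath

variable {P : Type u} {times star : P → P → P}

/-- The last entry `pₖ`. -/
def last (p : PPath times star) : P := (p.head :: p.tail).getLast (List.cons_ne_nil _ _)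

/-- The path `(p)` of length 1. -/
def single (p : P) : PPath times star := ⟨p, [], List.isChain_singleton p⟩

/-- The path `(p, q)` of length 2. -/
def pair (p q : P) (h : friendly times star p q) : PPath times star :=
  ⟨p, [q], List.isChain_pair.2 h⟩

/-- `(p₁, …, pₖ) ∘ (q₁, …, qₗ) = (p₁, …, pₖ = q₁, q₂, …, qₗ)`. -/
def comp (p q : PPath times star) (h : p.last = q.head) : PPath times star where
  head := p.head
  tail := p.tail ++ q.tail
  chain := by
    have hq := q.chain
    rw [← List.cons_append]
    refine List.IsChain.append p.chain hq.tail ?_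
    intro x hx y hy
    rw [List.getLast?_eq_some_getLast (List.cons_ne_nil _ _), Option.mem_some_iff] at hx
    subst hx
    cases hqt : q.tail with
    | nil => rw [hqt] at hy; simp at hy
    | cons z t =>
      rw [hqt] at hy hq
      have hz : z = y := by simpa using hy
      subst hz
      change friendly times star p.last z
      rw [h]
      exact (List.isChain_cons_cons.1 hq).1

/-- From `q` and `[p₂, …, pₖ]`, the list `[q₂, …, qₖ]` with `q₁ = q` and `qᵢ = qᵢ₋₁ ⋆ pᵢ`. -/
def restrictTail (star : P → P → P) : P → List P → List P
  | _, [] => []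
  | q, p :: ps => star q p :: restrictTail star (star q p) ps

/-- The order of the path category: `𝔭 ≤ 𝔮` if `𝔭` is the left restriction of `𝔮` to
some `r ≤_P q₁`. -/
def LE (p q : PPath times star) : Prop :=
  ∃ r, projLE times r q.head ∧ p.head = r ∧ p.tail = restrictTail star r q.tail

/-- The image of a path under a map which preserves `×` and `⋆`. -/
def map {Q : Type v} {times' star' : Q → Q → Q} (g : P → Q)
    (ht : ∀ e f, g (times e f) = times' (g e) (g f))
    (hs : ∀ e f, g (star e f) = star' (g e) (g f)) (p : PPath times star) :
    PPath times' star' where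
  head := g p.head
  tail := p.tail.map g
  chain := by
    rw [← List.map_cons, List.isChain_map]
    refine p.chain.imp ?_
    rintro a b ⟨h1, h2⟩
    exact ⟨(congrArg g h1).trans (ht _ _), (congrArg g h2).trans (hs _ _)⟩

end PPath

namespace IsStrongProjAlg

variable {P : Type u} {times star : P → P → P}

theorem times_le (h : IsStrongProjAlg times star) (e f : P) :
    projLE times (times e f) e := by
  have := h.L4 e e f
  rwa [h.L1] at this

theorem star_le (h : IsStrongProjAlg times star) (e f : P) :
    projLE times (star e f) f := (h.P4_star e f).symm

theorem star_eq_of_le (h : IsStrongProjAlg times star) {e f : P} (hef : projLE times e f) :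
    star e f = e := by
  have := h.P4_times f e
  rwa [← (show e = times f e from hef)] at this

theorem star_eq_of_le' (h : IsStrongProjAlg times star) {e f : P} (hef : projLE times e f) :
    star f e = e := by
  have := h.R2 f e
  rw [h.star_eq_of_le hef] at this
  exact this.symm

theorem times_eq_of_le (h : IsStrongProjAlg times star) {e f : P} (hef : projLE times e f) :
    times e f = e := by
  have := h.L2 f e
  rwa [← (show e = times f e from hef)] at this

theorem times_star_self (h : IsStrongProjAlg times star) (e f : P) :
    times e (star e f) = times e f := by
  have := h.P3_times f f e
  rwa [h.times_eq_of_le (h.star_le e f), h.L1] at this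

theorem star_times_self (h : IsStrongProjAlg times star) (e f : P) :
    star (times e f) f = star e f := by
  have := h.P3_star e e f
  rwa [h.star_eq_of_le' (h.times_le e f), h.R1] at this

/-- `e × f` and `e ⋆ f` form a path. -/
theorem friendly_times_star (h : IsStrongProjAlg times star) (e f : P) :
    friendly times star (times e f) (star e f) := by
  constructor
  · rw [h.L4, h.times_star_self, h.L1]
  · rw [h.R4, h.star_times_self, h.R1]

theorem times_eq_of_times_eq_of_le (h : IsStrongProjAlg times star) {p q r : P}
    (hpq : p = times p q) (hqr : projLE times q r) : p = times p r := by
  calc p = times p (times r q) := by rw [← (show q = times r q from hqr)]; exact hpq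
    _ = times (times p r) q := by rw [h.L3, ← (show q = times r q from hqr)]
    _ = times (times p r) (times p q) := h.L4 _ _ _
    _ = times p r := by rw [← hpq, h.L2]

theorem star_eq_of_star_eq_of_le (h : IsStrongProjAlg times star) {p q r : P}
    (hpq : q = star p q) (hpr : projLE times p r) : q = star r q := by
  have hp : star p r = p := h.star_eq_of_le hpr
  calc q = star (star p r) q := by rw [hp]; exact hpq
    _ = star p (star r q) := by rw [h.R3, hp]
    _ = star (star p q) (star r q) := h.R4 _ _ _
    _ = star r q := by rw [← hpq, ← h.R2]

end IsStrongProjAlg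

/-! ### Ordered categories -/

/-- A small category in single-sorted form: `a ∘ b` is defined precisely when `r(a) = d(b)`. -/
structure SmallCat (C : Type u) : Type u where
  dom : C → C
  cod : C → C
  comp : (a b : C) → cod a = dom b → C
  dom_comp : ∀ a b h, dom (comp a b h) = dom a
  cod_comp : ∀ a b h, cod (comp a b h) = cod b
  assoc : ∀ a b c (h : cod a = dom b) (k : cod b = dom c),
    comp (comp a b h) c ((cod_comp a b h).trans k) =
      comp a (comp b c k) (h.trans (dom_comp b c k).symm)
  cod_dom : ∀ a, cod (dom a) = dom a
  dom_cod : ∀ a, cod a = dom (cod a)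
  id_comp : ∀ a, comp (dom a) a (cod_dom a) = a
  comp_id : ∀ a, comp a (cod a) (dom_cod a) = a

namespace SmallCat

variable {C : Type u} (K : SmallCat C)

/-- The set of objects `P_C = {d(x) | x ∈ C} = {r(x) | x ∈ C}`. -/
def Obj : Type u := {p : C // ∃ x, K.dom x = p}

instance : CoeOut K.Obj C := ⟨Subtype.val⟩

def domObj (a : C) : K.Obj := ⟨K.dom a, a, rfl⟩

def codObj (a : C) : K.Obj := ⟨K.cod a, K.cod a, (K.dom_cod a).symm⟩

end SmallCat

/-- `(C, ∘, d, r, ≤)` is an ordered category. -/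
structure IsOrderedCat {C : Type u} (K : SmallCat C) (le : C → C → Prop) : Prop where
  refl : ∀ a, le a a
  antisymm : ∀ a b, le a b → le b a → a = b
  trans : ∀ a b c, le a b → le b c → le a c
  O1_dom : ∀ a b, le a b → le (K.dom a) (K.dom b)
  O1_cod : ∀ a b, le a b → le (K.cod a) (K.cod b)
  O2 : ∀ a b c d (h : K.cod a = K.dom c) (k : K.cod b = K.dom d),
    le a b → le c d → le (K.comp a c h) (K.comp b d k)
  O3 : ∀ (a : C) (p : K.Obj), le p (K.dom a) → ∃! u, le u a ∧ K.dom u = p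
  O4 : ∀ (a : C) (q : K.Obj), le q (K.cod a) → ∃! v, le v a ∧ K.cod v = q

namespace IsOrderedCat

variable {C : Type u} {K : SmallCat C} {le : C → C → Prop}

/-- The left restriction of `a` to `p ≤ d(a)`. -/
noncomputable def lres (h : IsOrderedCat K le) (p : K.Obj) (a : C) (hp : le p (K.dom a)) : C :=
  (h.O3 a p hp).choose

/-- The right restriction of `a` to `q ≤ r(a)`. -/
noncomputable def rres (h : IsOrderedCat K le) (a : C) (q : K.Obj) (hq : le q (K.cod a)) : C :=
  (h.O4 a q hq).choose

theorem lres_le (h : IsOrderedCat K le) (p : K.Obj) (a : C) (hp : le p (K.dom a)) :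
    le (h.lres p a hp) a := (h.O3 a p hp).choose_spec.1.1

theorem dom_lres (h : IsOrderedCat K le) (p : K.Obj) (a : C) (hp : le p (K.dom a)) :
    K.dom (h.lres p a hp) = p := (h.O3 a p hp).choose_spec.1.2

theorem rres_le (h : IsOrderedCat K le) (a : C) (q : K.Obj) (hq : le q (K.cod a)) :
    le (h.rres a q hq) a := (h.O4 a q hq).choose_spec.1.1

theorem cod_rres (h : IsOrderedCat K le) (a : C) (q : K.Obj) (hq : le q (K.cod a)) :
    K.cod (h.rres a q hq) = q := (h.O4 a q hq).choose_spec.1.2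

end IsOrderedCat

/-! ### Chain projection ordered categories -/

/-- The data `(∘, d, r, ≤, ×, ⋆, ε)` on `C`: a small category with a relation `≤`, two binary
operations on its set of objects, and a map from the paths of objects to `C`. -/
structure CPOData (C : Type u) extends SmallCat C where
  le : C → C → Prop
  times : toSmallCat.Obj → toSmallCat.Obj → toSmallCat.Obj
  star : toSmallCat.Obj → toSmallCat.Obj → toSmallCat.Obj
  eval : PPath times star → C

/-- A weak projection ordered category. -/
structure IsWeakPOC {C : Type u} (D : CPOData C) : Prop where
  ordered : IsOrderedCat D.toSmallCat D.le
  strong : IsStrongProjAlg D.times D.star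
  le_iff : ∀ p q : D.Obj, D.le p q ↔ projLE D.times p q

namespace IsWeakPOC

variable {C : Type u} {D : CPOData C}

theorem star_dom_le (h : IsWeakPOC D) (x : D.Obj) (a : C) :
    D.le (D.star x (D.domObj a) : D.Obj) (D.dom a) :=
  (h.le_iff _ (D.domObj a)).2 (h.strong.star_le _ _)

theorem cod_times_le (h : IsWeakPOC D) (a : C) (y : D.Obj) :
    D.le (D.times (D.codObj a) y : D.Obj) (D.cod a) :=
  (h.le_iff _ (D.codObj a)).2 (h.strong.times_le _ _)

/-- `x Θ_a = r(u)`, where `u` is the left restriction of `a` to `x ⋆ d(a)`. -/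
noncomputable def Theta (h : IsWeakPOC D) (a : C) (x : D.Obj) : D.Obj :=
  D.codObj (h.ordered.lres (D.star x (D.domObj a)) a (h.star_dom_le x a))

/-- `y Δ_a = d(v)`, where `v` is the right restriction of `a` to `r(a) × y`. -/
noncomputable def Delta (h : IsWeakPOC D) (a : C) (y : D.Obj) : D.Obj :=
  D.domObj (h.ordered.rres a (D.times (D.codObj a) y) (h.cod_times_le a y))

theorem Theta_le (h : IsWeakPOC D) (a : C) (x : D.Obj) :
    projLE D.times (h.Theta a x) (D.codObj a) :=
  (h.le_iff _ _).1 (h.ordered.O1_cod _ _ (h.ordered.lres_le _ _ _))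

theorem Delta_le (h : IsWeakPOC D) (a : C) (y : D.Obj) :
    projLE D.times (h.Delta a y) (D.domObj a) :=
  (h.le_iff _ _).1 (h.ordered.O1_dom _ _ (h.ordered.rres_le _ _ _))

end IsWeakPOC

/-- A projection ordered category. With maps written on the right, `q θ_p = q ⋆ p` and
`q δ_p = p × q`, the last two conditions read `δ_{pΘ_a} = Δ_a δ_p Θ_a` and
`θ_{pΔ_a} = Θ_a θ_p Δ_a`. -/
structure IsPOC {C : Type u} (D : CPOData C) : Prop extends IsWeakPOC D where
  times_Theta : ∀ (a : C) (p x : D.Obj),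
    D.times (toIsWeakPOC.Theta a p) x =
      toIsWeakPOC.Theta a (D.times p (toIsWeakPOC.Delta a x))
  star_Delta : ∀ (a : C) (p x : D.Obj),
    D.star x (toIsWeakPOC.Delta a p) =
      toIsWeakPOC.Delta a (D.star (toIsWeakPOC.Theta a x) p)

/-- `ε` is an evaluation map. -/
structure IsEvaluation {C : Type u} (D : CPOData C) : Prop where
  E1_single : ∀ p : D.Obj, D.eval (PPath.single p) = p
  E1_pair : ∀ (p : D.Obj) (h : friendly D.times D.star p p), D.eval (PPath.pair p p h) = p
  E2_dom : ∀ p : PPath D.times D.star, D.dom (D.eval p) = p.head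
  E2_cod : ∀ p : PPath D.times D.star, D.cod (D.eval p) = p.last
  E3 : ∀ (p q : PPath D.times D.star) (h : p.last = q.head),
    D.eval (p.comp q h) = D.comp (D.eval p) (D.eval q)
      ((E2_cod p).trans ((congrArg Subtype.val h).trans (E2_dom q).symm))
  E4 : ∀ p q : PPath D.times D.star, p.LE q → D.le (D.eval p) (D.eval q)

namespace IsEvaluation

variable {C : Type u} {D : CPOData C}

theorem dom_pair (hε : IsEvaluation D) {p q : D.Obj} (h : friendly D.times D.star p q) :
    D.dom (D.eval (PPath.pair p q h)) = p := hε.E2_dom _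

theorem cod_pair (hε : IsEvaluation D) {p q : D.Obj} (h : friendly D.times D.star p q) :
    D.cod (D.eval (PPath.pair p q h)) = q := hε.E2_cod _

end IsEvaluation

namespace IsPOC

variable {C : Type u} {D : CPOData C}

/-- `(e, f)` is a `b`-linked pair: `f = e Θ_b θ_f` and `e = f Δ_b δ_e`. -/
def Linked (h : IsPOC D) (b : C) (e f : D.Obj) : Prop :=
  f = D.star (h.Theta b e) f ∧ e = D.times e (h.Delta b f)

theorem Linked.friendly_e₁ {h : IsPOC D} {b : C} {e f : D.Obj} (l : h.Linked b e f) :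
    friendly D.times D.star e (D.star e (D.domObj b)) := by
  have he : e = D.times e (D.domObj b) :=
    h.strong.times_eq_of_times_eq_of_le l.2 (h.Delta_le b f)
  have := h.strong.friendly_times_star e (D.domObj b)
  rwa [← he] at this

theorem Linked.friendly_f₁ {h : IsPOC D} {b : C} {e f : D.Obj} (l : h.Linked b e f) :
    friendly D.times D.star (h.Theta b e) f := by
  refine ⟨?_, l.1⟩
  rw [h.times_Theta, ← l.2]

theorem Linked.friendly_e₂ {h : IsPOC D} {b : C} {e f : D.Obj} (l : h.Linked b e f) :
    friendly D.times D.star e (h.Delta b f) := by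
  refine ⟨l.2, ?_⟩
  rw [h.star_Delta, ← l.1]

theorem Linked.friendly_f₂ {h : IsPOC D} {b : C} {e f : D.Obj} (l : h.Linked b e f) :
    friendly D.times D.star (D.times (D.codObj b) f) f := by
  have hf : f = D.star (D.codObj b) f :=
    h.strong.star_eq_of_star_eq_of_le l.1 (h.Theta_le b e)
  have := h.strong.friendly_times_star (D.codObj b) f
  rwa [← hf] at this

/-- `λ(e,b,f) = ε(e,e₁) ∘ b' ∘ ε(f₁,f)`, where `e₁ = e ⋆ d(b)`, `f₁ = e Θ_b` and `b'` is the left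
restriction of `b` to `e₁`. -/
noncomputable def lam (h : IsPOC D) (hε : IsEvaluation D) {b : C} {e f : D.Obj}
    (l : h.Linked b e f) : C :=
  D.comp
    (D.comp (D.eval (PPath.pair e (D.star e (D.domObj b)) l.friendly_e₁))
      (h.ordered.lres (D.star e (D.domObj b)) b (h.star_dom_le e b))
      ((hε.cod_pair _).trans (h.ordered.dom_lres _ _ _).symm))
    (D.eval (PPath.pair (h.Theta b e) f l.friendly_f₁))
    ((D.cod_comp _ _ _).trans (hε.dom_pair l.friendly_f₁).symm)

/-- `ρ(e,b,f) = ε(e,e₂) ∘ b' ∘ ε(f₂,f)`, where `e₂ = f Δ_b`, `f₂ = r(b) × f` and `b'` is the right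
restriction of `b` to `f₂`. -/
noncomputable def rho (h : IsPOC D) (hε : IsEvaluation D) {b : C} {e f : D.Obj}
    (l : h.Linked b e f) : C :=
  D.comp
    (D.comp (D.eval (PPath.pair e (h.Delta b f) l.friendly_e₂))
      (h.ordered.rres b (D.times (D.codObj b) f) (h.cod_times_le b f))
      (hε.cod_pair l.friendly_e₂))
    (D.eval (PPath.pair (D.times (D.codObj b) f) f l.friendly_f₂))
    ((D.cod_comp _ _ _).trans ((h.ordered.cod_rres _ _ _).trans (hε.dom_pair _).symm))

end IsPOC

/-- A chain projection ordered category. -/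
structure IsCPOC {C : Type u} (D : CPOData C) : Prop extends IsPOC D where
  evaluation : IsEvaluation D
  G2 : ∀ (b : C) (e f : D.Obj) (l : toIsPOC.Linked b e f),
    toIsPOC.lam evaluation l = toIsPOC.rho evaluation l

/-- The map on objects induced by a map that commutes with `d`. -/
def mapObj {C₁ : Type u} {C₂ : Type v} {K₁ : SmallCat C₁} {K₂ : SmallCat C₂} (φ : C₁ → C₂)
    (h : ∀ a, K₂.dom (φ a) = φ (K₁.dom a)) (p : K₁.Obj) : K₂.Obj :=
  ⟨φ p, φ p, (h p).trans (congrArg φ (by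
    obtain ⟨_, x, rfl⟩ := p
    exact (congrArg K₁.dom (K₁.cod_dom x).symm).trans ((K₁.dom_cod _).symm.trans (K₁.cod_dom x))))⟩

/-- A chain projection ordered functor. -/
structure IsCPOFunctor {C₁ : Type u} {C₂ : Type v} (D₁ : CPOData C₁) (D₂ : CPOData C₂)
    (φ : C₁ → C₂) : Prop where
  F1_dom : ∀ a, D₂.dom (φ a) = φ (D₁.dom a)
  F1_cod : ∀ a, D₂.cod (φ a) = φ (D₁.cod a)
  F2 : ∀ a b (h : D₁.cod a = D₁.dom b), φ (D₁.comp a b h) =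
    D₂.comp (φ a) (φ b) ((F1_cod a).trans ((congrArg φ h).trans (F1_dom b).symm))
  F3 : ∀ a b, D₁.le a b → D₂.le (φ a) (φ b)
  F4_times : ∀ e f : D₁.Obj,
    mapObj φ F1_dom (D₁.times e f) = D₂.times (mapObj φ F1_dom e) (mapObj φ F1_dom f)
  F4_star : ∀ e f : D₁.Obj,
    mapObj φ F1_dom (D₁.star e f) = D₂.star (mapObj φ F1_dom e) (mapObj φ F1_dom f)
  F5 : ∀ p : PPath D₁.times D₁.star,
    φ (D₁.eval p) = D₂.eval (p.map (mapObj φ F1_dom) F4_times F4_star)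

/-- The objects of the category of (non-empty) chain projection ordered categories. -/
structure CPOC : Type (u + 1) where
  carrier : Type u
  nonempty : Nonempty carrier
  data : CPOData carrier
  isCPOC : IsCPOC data

namespace CPOC

@[ext]
structure Hom (C₁ C₂ : CPOC.{u}) : Type u where
  toFun : C₁.carrier → C₂.carrier
  isFunctor : IsCPOFunctor C₁.data C₂.data toFun

theorem isCPOFunctor_id {C : Type u} (D : CPOData C) : IsCPOFunctor D D (fun x => x) where
  F1_dom _ := rfl
  F1_cod _ := rfl
  F2 _ _ _ := rfl
  F3 _ _ h := h
  F4_times _ _ := rfl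
  F4_star _ _ := rfl
  F5 _ := congrArg D.eval (PPath.ext rfl (List.map_id _).symm)

theorem isCPOFunctor_comp {C₁ C₂ C₃ : Type u} {D₁ : CPOData C₁} {D₂ : CPOData C₂}
    {D₃ : CPOData C₃} {φ : C₁ → C₂} {ψ : C₂ → C₃} (f : IsCPOFunctor D₁ D₂ φ)
    (g : IsCPOFunctor D₂ D₃ ψ) : IsCPOFunctor D₁ D₃ (fun x => ψ (φ x)) where
  F1_dom a := (g.F1_dom _).trans (congrArg ψ (f.F1_dom a))
  F1_cod a := (g.F1_cod _).trans (congrArg ψ (f.F1_cod a))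
  F2 a b h := (congrArg ψ (f.F2 a b h)).trans (g.F2 _ _ _)
  F3 _ _ h := g.F3 _ _ (f.F3 _ _ h)
  F4_times e e' := (congrArg (mapObj ψ g.F1_dom) (f.F4_times e e')).trans (g.F4_times _ _)
  F4_star e e' := (congrArg (mapObj ψ g.F1_dom) (f.F4_star e e')).trans (g.F4_star _ _)
  F5 p := (congrArg ψ (f.F5 p)).trans ((g.F5 _).trans
    (congrArg D₃.eval (PPath.ext rfl List.map_map)))

instance : Category CPOC.{u} where
  Hom C₁ C₂ := Hom C₁ C₂
  id C := ⟨fun x => x, isCPOFunctor_id C.data⟩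
  comp f g := ⟨fun x => g.toFun (f.toFun x), isCPOFunctor_comp f.isFunctor g.isFunctor⟩

end CPOC

/-! ### The construction `C` -/

/-- The category of a DRC-restriction semigroup `S` under the restricted product:
`a ∘ b = ab`, defined when `a* = b⁺`, with `d(a) = a⁺` and `r(a) = a*`. -/
def restrictedCat {S : Type u} [BiUnary S] (hS : IsDRCRestriction S) : SmallCat S where
  dom := plus
  cod := ast
  comp a b _ := a * b
  dom_comp a b h := by
    rw [hS.plus_congr, ← h, hS.mul_ast]
  cod_comp a b h := by
    rw [hS.ast_congr, h, hS.plus_mul]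
  assoc a b c _ _ := hS.mul_assoc a b c
  cod_dom := hS.ast_plus
  dom_cod a := (hS.plus_ast a).symm
  id_comp := hS.plus_mul
  comp_id := hS.mul_ast

/-- The natural order `a ≤ b ↔ a = a⁺ b ∧ b⁺ a⁺ b⁺ = a⁺` of a DRC-restriction semigroup. -/
def naturalLE {S : Type u} [BiUnary S] (a b : S) : Prop :=
  a = plus a * b ∧ plus b * plus a * plus b = plus a

/-- The data of `C(S)`: the restricted product, `d(a) = a⁺`, `r(a) = a*`, the natural order,
`e × f = (ef)⁺`, `e ⋆ f = (ef)*` and `ε(p₁, …, pₖ) = p₁ ⋯ pₖ`. -/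
def cData {S : Type u} [BiUnary S] (hS : IsDRCRestriction S) : CPOData S where
  toSmallCat := restrictedCat hS
  le := naturalLE
  times e f := ⟨plus (e.1 * f.1), e.1 * f.1, rfl⟩
  star e f := ⟨ast (e.1 * f.1), ast (e.1 * f.1), hS.plus_ast _⟩
  eval p := p.tail.foldl (fun x q => x * q.1) p.head.1

/-! ### The construction `S` -/

/-- The pseudo-product `a • b = a' ∘ ε(r(a) × d(b), r(a) ⋆ d(b)) ∘ b'`, where `a'` is the right
restriction of `a` to `r(a) × d(b)` and `b'` the left restriction of `b` to `r(a) ⋆ d(b)`. -/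
noncomputable def pseudoProduct {C : Type u} {D : CPOData C} (h : IsCPOC D) (a b : C) : C :=
  D.comp
    (D.comp
      (h.ordered.rres a (D.times (D.codObj a) (D.domObj b)) (h.cod_times_le a (D.domObj b)))
      (D.eval (PPath.pair _ _ (h.strong.friendly_times_star (D.codObj a) (D.domObj b))))
      ((h.ordered.cod_rres _ _ _).trans (h.evaluation.dom_pair _).symm))
    (h.ordered.lres (D.star (D.codObj a) (D.domObj b)) b (h.star_dom_le (D.codObj a) b))
    ((D.cod_comp _ _ _).trans
      ((h.evaluation.cod_pair _).trans (h.ordered.dom_lres _ _ _).symm))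

/-- The operations of `S(C)`: the pseudo-product, `a⁺ = d(a)` and `a* = r(a)`. -/
noncomputable abbrev sData {C : Type u} {D : CPOData C} (h : IsCPOC D) : BiUnary C where
  mul := pseudoProduct h
  plus := D.dom
  ast := D.cod

/-! ### The two functors -/

/-- `C` as a functor, identical on underlying sets and maps; the hypotheses say that `C` sends
objects to objects and morphisms to morphisms. -/
def functorC
    (hobj : ∀ S : DRS.{u}, IsCPOC (cData S.isDRCRestriction))
    (hmap : ∀ (S T : DRS.{u}) (f : S ⟶ T),
      IsCPOFunctor (cData S.isDRCRestriction) (cData T.isDRCRestriction) f.toFun) :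
    DRS.{u} ⥤ CPOC.{u} where
  obj S := ⟨S.carrier, S.nonempty, cData S.isDRCRestriction, hobj S⟩
  map f := ⟨f.toFun, hmap _ _ f⟩
  map_id _ := rfl
  map_comp _ _ := rfl

/-- `S` as a functor, identical on underlying sets and maps; the hypotheses say that `S` sends
objects to objects and morphisms to morphisms. -/
noncomputable def functorS
    (hobj : ∀ C : CPOC.{u}, @IsDRCRestriction C.carrier (sData C.isCPOC))
    (hmap : ∀ (C₁ C₂ : CPOC.{u}) (f : C₁ ⟶ C₂),
      @IsBiUnaryHom C₁.carrier C₂.carrier (sData C₁.isCPOC) (sData C₂.isCPOC) f.toFun) :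
    CPOC.{u} ⥤ DRS.{u} where
  obj C := ⟨C.carrier, C.nonempty, sData C.isCPOC, hobj C⟩
  map f := ⟨f.toFun, hmap _ _ f⟩
  map_id _ := rfl
  map_comp _ _ := rfl

end DRC

namespace DRC

open BiUnary

/-! ### Calculations in DRC-restriction semigroups -/

/-! In a DRC-restriction semigroup every product can be rewritten so that ranges and domains match:
ab = a(a*b⁺)⁺ · (a*b⁺)⁺(a*b⁺)* · (a*b⁺)*b. The outer factors are restrictions of a and b, and the
middle one, which equals a*b⁺, is the evaluation of the path (a* × b⁺, a* ⋆ b⁺). Hence the ordered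
category, the projection algebra and the evaluation map together determine the multiplication, and
this factorization is the pseudo-product.

From semigroups to categories the ample conditions carry the argument. They make the natural order
left-right symmetric (`naturalLE_dual`), so that restriction on either side is multiplication by a
projection; they give the strong axioms (`times_star_times`) and the laws for Θ and Δ
(`times_theta`). The condition on linked pairs holds because both of its sides equal ebf. Left-right
duality supplies the other half of each argument.

From categories to semigroups the main point is associativity. Put e = r(a) × d(c)Δ_b and f =
r(a)Θ_b ⋆ d(c), a b-linked pair (`linked`). Both bracketings of a, b, c begin with the restriction
of a to e and end with the restriction of c to f; the middle factor is λ(e,b,f) for (a • b) • c and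
ρ(e,b,f) for a • (b • c), and λ = ρ is the linked-pair condition. The other axioms follow because
multiplication by a suitable object is restriction.

Both constructions keep the set, d and r. Mutual inverseness thus amounts to recovering the product
(`IsDRCRestriction.pseudoProduct_eq`) and, conversely, the composition, order, ×, ⋆ and ε
(`cData_sData`). -/

/-- The opposite bi-unary structure: reversed product, with `⁺` and `*` exchanged. -/
abbrev BiUnary.opp (S : Type u) [BiUnary S] : BiUnary S where
  mul x y := y * x
  plus := ast
  ast := plus

namespace IsDRCRestriction

variable {S : Type u} [BiUnary S]

/-- The axioms form mirror pairs, up to reassociating the two sandwich laws. Every one-sided fact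
below therefore yields its dual when applied to `BiUnary.opp S`. -/
theorem opp (hS : IsDRCRestriction S) : @IsDRCRestriction S (BiUnary.opp S) :=
  @IsDRCRestriction.mk S (BiUnary.opp S)
    (@IsDRCSemigroup.mk S (BiUnary.opp S) (fun x y z => (hS.mul_assoc z y x).symm)
      hS.mul_ast hS.plus_mul (fun x y => hS.ast_congr y x) (fun x y => hS.plus_congr y x)
      (fun x y => (hS.ast_reduced y x).trans (hS.mul_assoc _ _ _))
      (fun x y => (hS.plus_reduced y x).trans (hS.mul_assoc _ _ _))
      hS.ast_ast hS.plus_plus hS.plus_ast hS.ast_plus)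
    hS.ample_right hS.ample_left

theorem ast_of_plus (hS : IsDRCRestriction S) {e : S} (he : plus e = e) : ast e = e := by
  rw [← he, hS.ast_plus]

theorem idem (hS : IsDRCRestriction S) {e : S} (he : plus e = e) : e * e = e := by
  have := hS.plus_mul e
  rwa [he] at this

theorem plus_mul_plus_mul (hS : IsDRCRestriction S) (x y : S) :
    plus x * plus (x * y) = plus (x * y) := by
  rw [hS.plus_reduced x y, ← hS.mul_assoc, ← hS.mul_assoc, hS.idem (hS.plus_plus x)]

theorem plus_mul_mul_plus (hS : IsDRCRestriction S) (x y : S) :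
    plus (x * y) * plus x = plus (x * y) := by
  rw [hS.plus_reduced x y, hS.mul_assoc, hS.idem (hS.plus_plus x)]

theorem ast_mul_mul_ast (hS : IsDRCRestriction S) (x y : S) :
    ast (x * y) * ast y = ast (x * y) :=
  @plus_mul_plus_mul S (BiUnary.opp S) hS.opp y x

theorem ast_mul_ast_mul (hS : IsDRCRestriction S) (x y : S) :
    ast y * ast (x * y) = ast (x * y) :=
  @plus_mul_mul_plus S (BiUnary.opp S) hS.opp y x

/-- `(ey)⁺ y = ey` for a projection `e`. -/
theorem plus_mul_right (hS : IsDRCRestriction S) {e : S} (he : plus e = e) (y : S) :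
    plus (e * y) * y = e * y := by
  have h := hS.plus_mul_mul_plus e y
  rw [he] at h
  calc plus (e * y) * y = plus (e * y) * (e * y) := by rw [← hS.mul_assoc, h]
    _ = e * y := hS.plus_mul _

/-- `x (xf)* = xf` for a projection `f`. -/
theorem mul_ast_right (hS : IsDRCRestriction S) {f : S} (hf : plus f = f) (x : S) :
    x * ast (x * f) = x * f :=
  @plus_mul_right S (BiUnary.opp S) hS.opp f (hS.ast_of_plus hf) x

/-! ### Identities behind the projection algebra axioms and the laws for Θ and Δ. -/

theorem times_times (hS : IsDRCRestriction S) {e : S} (he : plus e = e) (f g : S) :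
    plus (e * plus (f * g)) = plus (plus (e * f) * plus (f * g)) := by
  rw [← hS.plus_congr, ← hS.plus_congr, ← hS.mul_assoc, ← hS.mul_assoc, hS.plus_mul_right he]

theorem times_times_left (hS : IsDRCRestriction S) {e : S} (he : plus e = e) (f g : S) :
    plus (plus (e * f) * g) = plus (plus (e * f) * plus (e * g)) := by
  have h := hS.plus_mul_mul_plus e f
  rw [he] at h
  rw [← hS.plus_congr, ← hS.mul_assoc, h]

/-- Both sides equal (efg)*, because (fg)⁺g = fg. -/
theorem star_times (hS : IsDRCRestriction S) {f : S} (hf : plus f = f) (e g : S) :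
    ast (ast (e * plus (f * g)) * g) = ast (ast (e * f) * g) := by
  rw [← hS.ast_congr, ← hS.ast_congr, hS.mul_assoc, hS.plus_mul_right hf, ← hS.mul_assoc]

/-- This is the strong axiom, where an ample condition is needed. With k = ((ef)⁺g)⁺ one has k(ef)⁺
= k and ke = k, so `ample_left` at ef and k gives ef(kf)* = kf. Since f absorbs into (kf)*, this
says e(kf)* = kf, and (kf)⁺ = (kef)⁺ = k. -/
theorem times_star_times (hS : IsDRCRestriction S) {e f : S} (he : plus e = e) (hf : plus f = f)
    (g : S) : plus (e * ast (plus (plus (e * f) * g) * f)) = plus (plus (e * f) * g) := by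
  have hp : plus (plus (plus (e * f) * g)) = plus (plus (e * f) * g) := hS.plus_plus _
  have hk : plus (plus (e * f) * g) * plus (e * f) = plus (plus (e * f) * g) := by
    have := hS.plus_mul_mul_plus (plus (e * f)) g
    rwa [hS.plus_plus] at this
  generalize plus (plus (e * f) * g) = k at hp hk
  have hke : k * e = k := by
    have := hS.plus_mul_mul_plus e f
    rw [he] at this
    rw [← hk, hS.mul_assoc, this]
  have h1 : e * f * ast (k * f) = k * f := by
    have := hS.ample_left (e * f) k
    rwa [hk, hS.ast_of_plus hp, ← hS.mul_assoc, hke] at this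
  have h2 : f * ast (k * f) = ast (k * f) := by
    have := hS.ast_mul_ast_mul k f
    rwa [hS.ast_of_plus hf] at this
  rw [hS.mul_assoc, h2] at h1
  rw [h1, show k * f = k * (e * f) by rw [← hS.mul_assoc, hke], hS.plus_congr, hk, hp]

/-- `(pΘ_a) × x = (p × (xΔ_a))Θ_a`, with `pΘ_a = (pa)*` and `xΔ_a = (ax)⁺`. -/
theorem times_theta (hS : IsDRCRestriction S) {p : S} (hp : plus p = p) (a x : S) :
    plus (ast (p * a) * x) = ast (plus (p * plus (a * x)) * a) := by
  -- This becomes (pax)⁺a = pa((pa)*x)⁺, because (pax)⁺p = (pax)⁺. Applying * to the right side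
  -- leaves ((pa)*x)⁺.
  have h := hS.ample_right (p * a) x
  have h1 := hS.plus_mul_mul_plus p (a * x)
  rw [hp] at h1
  rw [hS.mul_assoc p a x, ← hS.mul_assoc _ p a, h1] at h
  rw [← hS.plus_congr, h, hS.ast_congr (p * a)]
  have h2 := hS.plus_mul_plus_mul (ast (p * a)) x
  rw [hS.plus_ast] at h2
  rw [h2, hS.ast_plus]

theorem star_delta (hS : IsDRCRestriction S) {p : S} (hp : plus p = p) (a x : S) :
    ast (x * plus (a * p)) = plus (a * ast (ast (x * a) * p)) :=
  @times_theta S (BiUnary.opp S) hS.opp p (hS.ast_of_plus hp) a x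

/-! ### The natural order -/

theorem naturalLE_iff (hS : IsDRCRestriction S) (a b : S) :
    naturalLE a b ↔ a = plus a * b ∧ plus b * plus a = plus a ∧ plus a * plus b = plus a := by
  refine and_congr_right fun _ => ⟨fun h => ?_, fun h => by rw [h.1, h.2]⟩
  constructor
  · rw [← h, ← hS.mul_assoc, ← hS.mul_assoc, hS.idem (hS.plus_plus b)]
  · rw [← h, hS.mul_assoc, hS.idem (hS.plus_plus b)]

/-- For a = a⁺b, `ample_left` gives ba* = b(a⁺b)* = (a⁺b⁺)*b = a⁺b = a. The order is thus the same
seen from either side, and right restrictions become dual to left ones. -/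
theorem naturalLE_dual (hS : IsDRCRestriction S) {a b : S} (h : naturalLE a b) :
    @naturalLE S (BiUnary.opp S) a b := by
  obtain ⟨h1, -, h3⟩ := (hS.naturalLE_iff a b).1 h
  have h4 := hS.ample_left b (plus a)
  rw [h3, hS.ast_plus, ← h1] at h4
  refine ⟨h4.symm, ?_⟩
  change ast b * (ast a * ast b) = ast a
  rw [h1, hS.ast_mul_mul_ast, hS.ast_mul_ast_mul]

theorem naturalLE_iff_dual (hS : IsDRCRestriction S) (a b : S) :
    naturalLE a b ↔ @naturalLE S (BiUnary.opp S) a b :=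
  ⟨hS.naturalLE_dual, @naturalLE_dual S (BiUnary.opp S) hS.opp a b⟩

theorem naturalLE_iff_projLE (hS : IsDRCRestriction S) {p q : S} (hp : plus p = p)
    (hq : plus q = q) : naturalLE p q ↔ p = plus (q * p) := by
  rw [hS.naturalLE_iff, hp, hq]
  constructor
  · rintro ⟨-, h, -⟩
    rw [h, hp]
  · intro h
    have h1 := hS.plus_mul_plus_mul q p
    have h2 := hS.plus_mul_mul_plus q p
    rw [← h, hq] at h1 h2
    exact ⟨h2.symm, h1, h2⟩

theorem plus_naturalLE (hS : IsDRCRestriction S) {a b : S} (h : naturalLE a b) :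
    naturalLE (plus a) (plus b) := by
  obtain ⟨-, h2, h3⟩ := (hS.naturalLE_iff a b).1 h
  rw [hS.naturalLE_iff, hS.plus_plus, hS.plus_plus]
  exact ⟨h3.symm, h2, h3⟩

theorem ast_naturalLE (hS : IsDRCRestriction S) {a b : S} (h : naturalLE a b) :
    naturalLE (ast a) (ast b) :=
  (hS.naturalLE_iff_dual _ _).2
    (@plus_naturalLE S (BiUnary.opp S) hS.opp a b ((hS.naturalLE_iff_dual _ _).1 h))

theorem existsUnique_restriction (hS : IsDRCRestriction S) (a : S) {p : S} (hp : plus p = p)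
    (h : naturalLE p (plus a)) : ∃! u, naturalLE u a ∧ plus u = p := by
  obtain ⟨-, h2, h3⟩ := (hS.naturalLE_iff _ _).1 h
  rw [hp, hS.plus_plus] at h2 h3
  have hd : plus (p * a) = p := by rw [hS.plus_congr, h3, hp]
  refine ⟨p * a, ⟨(hS.naturalLE_iff _ _).2 ?_, hd⟩, ?_⟩
  · rw [hd]
    exact ⟨rfl, h2, h3⟩
  · rintro u ⟨hu, rfl⟩
    exact hu.1

theorem isOrderedCat (hS : IsDRCRestriction S) : IsOrderedCat (restrictedCat hS) naturalLE where
  refl a := (hS.naturalLE_iff a a).2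
    ⟨(hS.plus_mul a).symm, hS.idem (hS.plus_plus a), hS.idem (hS.plus_plus a)⟩
  antisymm a b hab hba := by
    obtain ⟨h1, h2, -⟩ := (hS.naturalLE_iff a b).1 hab
    obtain ⟨-, -, k⟩ := (hS.naturalLE_iff b a).1 hba
    rw [h1, ← h2, k, hS.plus_mul]
  trans a b c hab hbc := by
    obtain ⟨h1, h2, h3⟩ := (hS.naturalLE_iff a b).1 hab
    obtain ⟨k1, k2, k3⟩ := (hS.naturalLE_iff b c).1 hbc
    refine (hS.naturalLE_iff a c).2 ⟨?_, ?_, ?_⟩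
    · rw [← h3, hS.mul_assoc, ← k1, ← h1]
    · rw [← h2, ← hS.mul_assoc, k2]
    · rw [← h3, hS.mul_assoc, k3]
  O1_dom _ _ h := hS.plus_naturalLE h
  O1_cod _ _ h := hS.ast_naturalLE h
  O2 a b c d h k hab hcd := by
    change ast a = plus c at h
    change ast b = plus d at k
    have e1 : plus (a * c) = plus a := by rw [hS.plus_congr, ← h, hS.mul_ast]
    have e2 : plus (b * d) = plus b := by rw [hS.plus_congr, ← k, hS.mul_ast]
    obtain ⟨h1, h2, h3⟩ := (hS.naturalLE_iff a b).1 hab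
    obtain ⟨k1, -, -⟩ := (hS.naturalLE_iff c d).1 hcd
    change naturalLE (a * c) (b * d)
    rw [hS.naturalLE_iff, e1, e2]
    refine ⟨?_, h2, h3⟩
    rw [← hS.mul_assoc, ← h1]
    rw [k1, ← h, ← hS.mul_assoc, hS.mul_ast]
  O3 a p hp := by
    refine hS.existsUnique_restriction a ?_ hp
    obtain ⟨_, x, rfl⟩ := p
    exact hS.plus_plus x
  O4 a q hq := by
    obtain ⟨_, x, rfl⟩ := q
    simp only [hS.naturalLE_iff_dual] at hq ⊢
    exact @existsUnique_restriction S (BiUnary.opp S) hS.opp a (plus x) (hS.ast_plus x) hq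

/-! ### The chain projection ordered category of a DRC-restriction semigroup -/

theorem plus_obj (hS : IsDRCRestriction S) (e : (cData hS).Obj) : plus e.1 = e.1 := by
  obtain ⟨_, x, rfl⟩ := e
  exact hS.plus_plus x

theorem ast_obj (hS : IsDRCRestriction S) (e : (cData hS).Obj) : ast e.1 = e.1 :=
  hS.ast_of_plus (hS.plus_obj e)

theorem isStrongProjAlg (hS : IsDRCRestriction S) :
    IsStrongProjAlg (cData hS).times (cData hS).star where
  L1 e := Subtype.ext <| by
    change plus (e.1 * e.1) = e.1
    rw [hS.idem (hS.plus_obj e), hS.plus_obj]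
  L2 e f := Subtype.ext <| by
    change plus (plus (e.1 * f.1) * e.1) = plus (e.1 * f.1)
    have := hS.plus_mul_mul_plus e.1 f.1
    rw [hS.plus_obj] at this
    rw [this, hS.plus_plus]
  L3 e f g := Subtype.ext (hS.times_times (hS.plus_obj e) f.1 g.1)
  L4 e f g := Subtype.ext (hS.times_times_left (hS.plus_obj e) f.1 g.1)
  R1 e := Subtype.ext <| by
    change ast (e.1 * e.1) = e.1
    rw [hS.idem (hS.plus_obj e), hS.ast_obj]
  R2 e f := Subtype.ext <| by
    change ast (f.1 * e.1) = ast (e.1 * ast (f.1 * e.1))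
    have := hS.ast_mul_ast_mul f.1 e.1
    rw [hS.ast_obj] at this
    rw [this, hS.ast_ast]
  R3 e f g := Subtype.ext
    (@times_times S (BiUnary.opp S) hS.opp e.1 (hS.ast_obj e) f.1 g.1)
  R4 e f g := Subtype.ext
    (@times_times_left S (BiUnary.opp S) hS.opp e.1 (hS.ast_obj e) f.1 g.1)
  P3_star e f g := Subtype.ext (hS.star_times (hS.plus_obj f) e.1 g.1)
  P3_times e f g := Subtype.ext
    (@star_times S (BiUnary.opp S) hS.opp f.1 (hS.ast_obj f) e.1 g.1)
  P4_times e f := Subtype.ext <| by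
    change ast (plus (e.1 * f.1) * e.1) = plus (e.1 * f.1)
    have := hS.plus_mul_mul_plus e.1 f.1
    rw [hS.plus_obj] at this
    rw [this, hS.ast_plus]
  P4_star e f := Subtype.ext <| by
    change plus (f.1 * ast (e.1 * f.1)) = ast (e.1 * f.1)
    have := hS.ast_mul_ast_mul e.1 f.1
    rw [hS.ast_obj] at this
    rw [this, hS.plus_ast]
  SP1 e f g := Subtype.ext (hS.times_star_times (hS.plus_obj e) (hS.plus_obj f) g.1)
  SP2 e f g := Subtype.ext
    (@times_star_times S (BiUnary.opp S) hS.opp e.1 f.1 (hS.ast_obj e) (hS.ast_obj f) g.1)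

theorem isWeakPOC (hS : IsDRCRestriction S) : IsWeakPOC (cData hS) where
  ordered := hS.isOrderedCat
  strong := hS.isStrongProjAlg
  le_iff p q :=
    (hS.naturalLE_iff_projLE (hS.plus_obj p) (hS.plus_obj q)).trans
      ⟨fun h => Subtype.ext h, fun h => congrArg Subtype.val h⟩

/-- The restriction is given only by a choice, but u = u⁺a, part of u ≤ a, forces its value. -/
theorem lres_eq (hS : IsDRCRestriction S) (h : IsOrderedCat (cData hS).toSmallCat (cData hS).le)
    (p : (cData hS).Obj) (a : S) (hp) : h.lres p a hp = p.1 * a := by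
  have h1 : h.lres p a hp = plus (h.lres p a hp) * a := (h.lres_le p a hp).1
  have h2 : plus (h.lres p a hp) = p.1 := h.dom_lres p a hp
  rwa [h2] at h1

theorem rres_eq (hS : IsDRCRestriction S) (h : IsOrderedCat (cData hS).toSmallCat (cData hS).le)
    (a : S) (q : (cData hS).Obj) (hq) : h.rres a q hq = a * q.1 := by
  have h1 : h.rres a q hq = a * ast (h.rres a q hq) := (hS.naturalLE_dual (h.rres_le a q hq)).1
  have h2 : ast (h.rres a q hq) = q.1 := h.cod_rres a q hq
  rwa [h2] at h1

theorem Theta_val (hS : IsDRCRestriction S) (h : IsWeakPOC (cData hS)) (a : S)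
    (x : (cData hS).Obj) : (h.Theta a x).1 = ast (x.1 * a) := by
  change ast (h.ordered.lres _ a _) = _
  rw [hS.lres_eq]
  change ast (ast (x.1 * plus a) * a) = _
  rw [← hS.ast_congr, hS.mul_assoc, hS.plus_mul]

theorem Delta_val (hS : IsDRCRestriction S) (h : IsWeakPOC (cData hS)) (a : S)
    (y : (cData hS).Obj) : (h.Delta a y).1 = plus (a * y.1) := by
  change plus (h.ordered.rres a _ _) = _
  rw [hS.rres_eq]
  change plus (a * plus (ast a * y.1)) = _
  rw [← hS.plus_congr, ← hS.mul_assoc, hS.mul_ast]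

theorem isPOC (hS : IsDRCRestriction S) : IsPOC (cData hS) where
  toIsWeakPOC := hS.isWeakPOC
  times_Theta a p x := Subtype.ext <| by
    rw [Theta_val]
    change plus ((hS.isWeakPOC.Theta a p).1 * x.1) =
      ast (plus (p.1 * (hS.isWeakPOC.Delta a x).1) * a)
    rw [Theta_val, Delta_val]
    exact hS.times_theta (hS.plus_obj p) a x.1
  star_Delta a p x := Subtype.ext <| by
    rw [Delta_val]
    change ast (x.1 * (hS.isWeakPOC.Delta a p).1) =
      plus (a * ast ((hS.isWeakPOC.Theta a x).1 * p.1))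
    rw [Theta_val, Delta_val]
    exact hS.star_delta (hS.plus_obj p) a x.1

/-! ### Products of projections along a path, and the evaluation map. -/

/-- The product `x p₁ ⋯ pₖ`. -/
abbrev mulList (hS : IsDRCRestriction S) (x : S) (l : List (cData hS).Obj) : S :=
  l.foldl (fun x q => x * q.1) x

theorem mul_mulList (hS : IsDRCRestriction S) (x y : S) (l : List (cData hS).Obj) :
    hS.mulList (x * y) l = x * hS.mulList y l := by
  induction l generalizing y with
  | nil => rfl
  | cons q l ih =>
    rw [mulList, List.foldl_cons, hS.mul_assoc]
    exact ih _

theorem plus_mulList (hS : IsDRCRestriction S) (p : (cData hS).Obj) (l : List (cData hS).Obj)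
    (h : List.IsChain (friendly (cData hS).times (cData hS).star) (p :: l)) :
    plus (hS.mulList p.1 l) = p.1 := by
  induction l generalizing p with
  | nil => exact hS.plus_obj p
  | cons q l ih =>
    obtain ⟨h1, h2⟩ := List.isChain_cons_cons.1 h
    rw [mulList, List.foldl_cons]
    change plus (hS.mulList (p.1 * q.1) l) = _
    rw [mul_mulList, hS.plus_congr, ih q h2]
    exact (congrArg Subtype.val h1.1).symm

theorem ast_mulList (hS : IsDRCRestriction S) (x : S) (p : (cData hS).Obj)
    (l : List (cData hS).Obj) (hx : ast x = p.1)
    (h : List.IsChain (friendly (cData hS).times (cData hS).star) (p :: l)) :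
    ast (hS.mulList x l) = ((p :: l).getLast (List.cons_ne_nil _ _)).1 := by
  induction l generalizing p x with
  | nil => exact hx
  | cons q l ih =>
    obtain ⟨h1, h2⟩ := List.isChain_cons_cons.1 h
    rw [List.getLast_cons_cons]
    refine ih (x * q.1) q ?_ h2
    rw [hS.ast_congr, hx]
    exact (congrArg Subtype.val h1.2).symm

/-- If x = xr, then x(rq)* = xr(rq)* = xrq = xq, so each restricted entry acts as the original one.
The product xq absorbs (rq)* in turn, which keeps the induction going. -/
theorem mulList_restrictTail (hS : IsDRCRestriction S) (x : S) (r : (cData hS).Obj)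
    (hx : x * r.1 = x) (l : List (cData hS).Obj) :
    hS.mulList x (PPath.restrictTail (cData hS).star r l) = hS.mulList x l := by
  induction l generalizing x r with
  | nil => rfl
  | cons q l ih =>
    rw [PPath.restrictTail, mulList, mulList, List.foldl_cons, List.foldl_cons]
    have h1 : x * ((cData hS).star r q).1 = x * q.1 := by
      change x * ast (r.1 * q.1) = _
      conv_lhs => rw [← hx]
      rw [hS.mul_assoc, hS.mul_ast_right (hS.plus_obj q), ← hS.mul_assoc, hx]
    refine (congrArg (fun y => hS.mulList y _) h1).trans (ih _ _ ?_)
    rw [← h1, hS.mul_assoc, hS.idem (hS.plus_obj _)]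

theorem isEvaluation (hS : IsDRCRestriction S) : IsEvaluation (cData hS) where
  E1_single p := rfl
  E1_pair p h := hS.idem (hS.plus_obj p)
  E2_dom p := hS.plus_mulList p.head p.tail p.chain
  E2_cod p := hS.ast_mulList p.head.1 p.head p.tail (hS.ast_obj _) p.chain
  E3 p q h := by
    change (p.tail ++ q.tail).foldl (fun x q => x * q.1) p.head.1 =
      hS.mulList p.head.1 p.tail * hS.mulList q.head.1 q.tail
    rw [List.foldl_append, ← mul_mulList]
    have hl := hS.ast_mulList p.head.1 p.head p.tail (hS.ast_obj _) p.chain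
    rw [← h, PPath.last, ← hl, hS.mul_ast]
  E4 p q h := by
    obtain ⟨r, hr, h1, h2⟩ := h
    have hle := (hS.naturalLE_iff_projLE (hS.plus_obj r) (hS.plus_obj q.head)).2
      (congrArg Subtype.val hr)
    obtain ⟨k1, k2, k3⟩ := (hS.naturalLE_iff _ _).1 hle
    rw [hS.plus_obj] at k1
    rw [hS.plus_obj, hS.plus_obj] at k2 k3
    change naturalLE (hS.mulList p.head.1 p.tail) (hS.mulList q.head.1 q.tail)
    rw [hS.naturalLE_iff, hS.plus_mulList _ _ p.chain, hS.plus_mulList _ _ q.chain, h1, h2,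
      mulList_restrictTail _ _ _ (hS.idem (hS.plus_obj r)), ← mul_mulList, ← k1]
    exact ⟨rfl, k2, rfl⟩

theorem isCPOC (hS : IsDRCRestriction S) : IsCPOC (cData hS) where
  toIsPOC := hS.isPOC
  evaluation := hS.isEvaluation
  G2 b e f l := by
    -- Both composites collapse to ebf: here e(eb⁺)* = eb⁺, and (eb⁺)* and (eb)* are absorbed by the
    -- factors on their left; for ρ the mirror argument applies.
    have h1 : hS.isPOC.lam hS.isEvaluation l = e.1 * b * f.1 := by
      change (e.1 * ast (e.1 * plus b)) * hS.isPOC.ordered.lres _ b _ *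
        ((hS.isPOC.Theta b e).1 * f.1) = _
      rw [Theta_val, lres_eq]
      change (e.1 * ast (e.1 * plus b)) * (ast (e.1 * plus b) * b) * (ast (e.1 * b) * f.1) = _
      rw [hS.mul_ast_right (hS.plus_plus b), ← hS.mul_assoc (e.1 * plus b), hS.mul_ast,
        hS.mul_assoc e.1, hS.plus_mul, ← hS.mul_assoc, hS.mul_ast]
    have h2 : hS.isPOC.rho hS.isEvaluation l = e.1 * b * f.1 := by
      change (e.1 * (hS.isPOC.Delta b f).1) * hS.isPOC.ordered.rres b _ _ *
        (plus (ast b * f.1) * f.1) = _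
      rw [Delta_val, rres_eq]
      change e.1 * plus (b * f.1) * (b * plus (ast b * f.1)) * (plus (ast b * f.1) * f.1) = _
      rw [hS.plus_mul_right (hS.plus_ast b), hS.mul_assoc, hS.mul_assoc b,
        hS.plus_mul, ← hS.mul_assoc b, hS.mul_ast, hS.mul_assoc, hS.plus_mul, ← hS.mul_assoc]
    rw [h1, h2]

/-! ### Homomorphisms as functors, and recovery of the product. -/

theorem map_mulList (hS : IsDRCRestriction S) {T : Type v} [BiUnary T] (hT : IsDRCRestriction T)
    {φ : S → T} (hφ : IsBiUnaryHom φ) (g : (cData hS).Obj → (cData hT).Obj)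
    (hg : ∀ q, (g q).1 = φ q.1) (x : S) (l : List (cData hS).Obj) :
    φ (hS.mulList x l) = hT.mulList (φ x) (l.map g) := by
  induction l generalizing x with
  | nil => rfl
  | cons q l ih =>
    refine (ih _).trans ?_
    rw [hφ.map_mul, ← hg]
    rfl

theorem isCPOFunctor (hS : IsDRCRestriction S) {T : Type v} [BiUnary T] (hT : IsDRCRestriction T)
    {φ : S → T} (hφ : IsBiUnaryHom φ) : IsCPOFunctor (cData hS) (cData hT) φ where
  F1_dom a := (hφ.map_plus a).symm
  F1_cod a := (hφ.map_ast a).symm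
  F2 a b _ := hφ.map_mul a b
  F3 a b h := by
    refine ⟨?_, ?_⟩
    · rw [← hφ.map_plus, ← hφ.map_mul, ← h.1]
    · rw [← hφ.map_plus, ← hφ.map_plus, ← hφ.map_mul, ← hφ.map_mul, h.2]
  F4_times e f := Subtype.ext ((hφ.map_plus _).trans (congrArg plus (hφ.map_mul _ _)))
  F4_star e f := Subtype.ext ((hφ.map_ast _).trans (congrArg ast (hφ.map_mul _ _)))
  F5 p := hS.map_mulList hT hφ _ (fun _ => rfl) _ _

/-- The pseudo-product of `C(S)` is the product of `S`. -/
theorem pseudoProduct_eq (hS : IsDRCRestriction S) (h : IsCPOC (cData hS)) (a b : S) :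
    pseudoProduct h a b = a * b := by
  change h.ordered.rres a _ _ * (plus (ast a * plus b) * ast (ast a * plus b)) *
    h.ordered.lres _ b _ = _
  rw [rres_eq, lres_eq]
  change a * plus (ast a * plus b) * (plus (ast a * plus b) * ast (ast a * plus b)) *
    (ast (ast a * plus b) * b) = _
  -- The evaluated two-term path is the product of projections a*b⁺ itself.
  have h1 : plus (ast a * plus b) * ast (ast a * plus b) = ast a * plus b := by
    have k1 := hS.ast_mul_ast_mul (ast a) (plus b)
    rw [hS.ast_plus] at k1
    rw [← k1, ← hS.mul_assoc, hS.plus_mul_right (hS.plus_ast a), hS.mul_ast]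
  rw [h1, hS.mul_assoc a, hS.plus_mul, ← hS.mul_assoc, hS.mul_assoc a, hS.mul_ast, hS.mul_assoc,
    hS.mul_assoc, hS.plus_mul, ← hS.mul_assoc, hS.mul_ast]

end IsDRCRestriction

/-! ### Composition and restriction in ordered categories -/

namespace SmallCat

variable {C : Type u} (K : SmallCat C)

theorem comp_congr {a a' b b' : C} (ha : a = a') (hb : b = b') (h : K.cod a = K.dom b)
    (h' : K.cod a' = K.dom b') : K.comp a b h = K.comp a' b' h' := by
  subst ha hb
  rfl

theorem dom_obj (p : K.Obj) : K.dom p = p := by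
  obtain ⟨_, x, rfl⟩ := p
  exact (congrArg K.dom (K.cod_dom x).symm).trans ((K.dom_cod _).symm.trans (K.cod_dom x))

theorem cod_obj (p : K.Obj) : K.cod p = p := by
  obtain ⟨_, x, rfl⟩ := p
  exact K.cod_dom x

theorem domObj_obj (p : K.Obj) : K.domObj p = p := Subtype.ext (K.dom_obj p)

theorem codObj_obj (p : K.Obj) : K.codObj p = p := Subtype.ext (K.cod_obj p)

theorem comp_eq_left {a b : C} (h : K.cod a = K.dom b) (hb : b = K.cod a) : K.comp a b h = a :=
  (K.comp_congr rfl hb h (K.dom_cod a)).trans (K.comp_id a)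

theorem comp_eq_right {a b : C} (h : K.cod a = K.dom b) (ha : a = K.dom b) : K.comp a b h = b :=
  (K.comp_congr ha rfl h (K.cod_dom b)).trans (K.id_comp b)

/-- This regrouping isolates the three middle factors; in a • (b • c) they form ρ. -/
theorem comp_comp_comp_comp {a b c d e : C} (hab : K.cod a = K.dom b) (hbc : K.cod b = K.dom c)
    (hcd : K.cod c = K.dom d) (h₁ h₂ h₃ h₄ h₅) :
    K.comp (K.comp a b hab) (K.comp (K.comp c d hcd) e h₁) h₂ =
      K.comp (K.comp a (K.comp (K.comp b c hbc) d h₃) h₄) e h₅ := by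
  have h₆ : K.cod (K.comp a b hab) = K.dom (K.comp c d hcd) :=
    (K.cod_comp _ _ _).trans (hbc.trans (K.dom_comp _ _ _).symm)
  refine (K.assoc (K.comp a b hab) (K.comp c d hcd) e h₆ h₁).symm.trans
    (K.comp_congr ?_ rfl _ _)
  refine (K.assoc (K.comp a b hab) c d ((K.cod_comp _ _ _).trans hbc) hcd).symm.trans ?_
  refine (K.comp_congr (K.assoc a b c hab hbc) rfl _ ?_).trans
    (K.assoc a (K.comp b c hbc) d (hab.trans (K.dom_comp _ _ _).symm) h₃)
  exact (K.cod_comp _ _ _).trans h₃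

end SmallCat

namespace IsOrderedCat

variable {C : Type u} {K : SmallCat C} {le : C → C → Prop}

theorem eq_of_dom_eq (h : IsOrderedCat K le) {u v a : C} (hu : le u a) (hv : le v a)
    (huv : K.dom u = K.dom v) : u = v :=
  (h.O3 a (K.domObj u) (h.O1_dom _ _ hu)).unique ⟨hu, rfl⟩ ⟨hv, huv.symm⟩

theorem eq_of_cod_eq (h : IsOrderedCat K le) {u v a : C} (hu : le u a) (hv : le v a)
    (huv : K.cod u = K.cod v) : u = v :=
  (h.O4 a (K.codObj u) (h.O1_cod _ _ hu)).unique ⟨hu, rfl⟩ ⟨hv, huv.symm⟩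

/-- The restriction of v to d(u) lies below a and has the same domain as u, hence is u. -/
theorem le_of_dom_le (h : IsOrderedCat K le) {u v a : C} (hu : le u a) (hv : le v a)
    (huv : le (K.dom u) (K.dom v)) : le u v := by
  have h1 := h.lres_le (K.domObj u) v huv
  rwa [← h.eq_of_dom_eq hu (h.trans _ _ _ h1 hv) (h.dom_lres (K.domObj u) v huv).symm] at h1

theorem le_of_cod_le (h : IsOrderedCat K le) {u v a : C} (hu : le u a) (hv : le v a)
    (huv : le (K.cod u) (K.cod v)) : le u v := by
  have h1 := h.rres_le v (K.codObj u) huv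
  rwa [← h.eq_of_cod_eq hu (h.trans _ _ _ h1 hv) (h.cod_rres v (K.codObj u) huv).symm] at h1

/-- An arrow below an object is an object. -/
theorem dom_eq_self (h : IsOrderedCat K le) {u : C} {p : K.Obj} (hu : le u p) : K.dom u = u := by
  have h1 := h.O1_dom _ _ hu
  rw [K.dom_obj] at h1
  exact h.eq_of_dom_eq h1 hu (K.dom_obj (K.domObj u))

end IsOrderedCat

/-! ### The pseudo-product -/

namespace IsCPOC

variable {C : Type u} {D : CPOData C}

/-- Arrows below a given arrow are determined by one end object, so any u ≤ a and v ≤ b with the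
right ends may replace the chosen restrictions. This is the working form of the pseudo-product. -/
theorem pseudoProduct_eq (h : IsCPOC D) {a b u v : C} {e f : D.Obj}
    (hef : friendly D.times D.star e f) (hu : D.le u a) (hv : D.le v b)
    (he : e = D.times (D.codObj a) (D.domObj b)) (hf : f = D.star (D.codObj a) (D.domObj b))
    (hue : D.cod u = e) (hvf : D.dom v = f) :
    pseudoProduct h a b =
      D.comp (D.comp u (D.eval (PPath.pair e f hef)) (hue.trans (h.evaluation.dom_pair hef).symm))
        v ((D.cod_comp _ _ _).trans ((h.evaluation.cod_pair hef).trans hvf.symm)) := by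
  subst he hf
  refine D.comp_congr (D.comp_congr ?_ rfl _ _) ?_ _ _
  · exact h.ordered.eq_of_cod_eq (h.ordered.rres_le _ _ _) hu
      ((h.ordered.cod_rres _ _ _).trans hue.symm)
  · exact h.ordered.eq_of_dom_eq (h.ordered.lres_le _ _ _) hv
      ((h.ordered.dom_lres _ _ _).trans hvf.symm)

theorem domObj_pseudoProduct (h : IsCPOC D) (a b : C) :
    D.domObj (pseudoProduct h a b) = h.Delta a (D.domObj b) :=
  Subtype.ext ((D.dom_comp _ _ _).trans (D.dom_comp _ _ _))

theorem codObj_pseudoProduct (h : IsCPOC D) (a b : C) :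
    D.codObj (pseudoProduct h a b) = h.Theta b (D.codObj a) :=
  Subtype.ext (D.cod_comp _ _ _)

theorem dom_pseudoProduct (h : IsCPOC D) (a b : C) :
    D.dom (pseudoProduct h a b) = h.Delta a (D.domObj b) :=
  congrArg Subtype.val (h.domObj_pseudoProduct a b)

theorem cod_pseudoProduct (h : IsCPOC D) (a b : C) :
    D.cod (pseudoProduct h a b) = h.Theta b (D.codObj a) :=
  congrArg Subtype.val (h.codObj_pseudoProduct a b)

theorem dom_pseudoProduct_le (h : IsCPOC D) (a b : C) :
    D.le (D.dom (pseudoProduct h a b)) (D.dom a) := by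
  rw [h.dom_pseudoProduct]
  exact (h.le_iff _ (D.domObj a)).2 (h.Delta_le _ _)

theorem cod_pseudoProduct_le (h : IsCPOC D) (a b : C) :
    D.le (D.cod (pseudoProduct h a b)) (D.cod b) := by
  rw [h.cod_pseudoProduct]
  exact (h.le_iff _ (D.codObj b)).2 (h.Theta_le _ _)

theorem friendly_self (h : IsCPOC D) (e : D.Obj) : friendly D.times D.star e e :=
  ⟨(h.strong.L1 e).symm, (h.strong.R1 e).symm⟩

theorem comp_eq_pseudoProduct (h : IsCPOC D) (a b : C) (hab : D.cod a = D.dom b) :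
    D.comp a b hab = pseudoProduct h a b := by
  have hd : D.domObj b = D.codObj a := Subtype.ext hab.symm
  rw [h.pseudoProduct_eq (h.friendly_self (D.codObj a)) (h.ordered.refl a) (h.ordered.refl b)
    (by rw [hd, h.strong.L1]) (by rw [hd, h.strong.R1]) rfl hab.symm]
  exact D.comp_congr (D.comp_eq_left _ (h.evaluation.E1_pair _ _)).symm rfl _ _

/-- Left restriction is left multiplication by a projection. -/
theorem dom_pseudoProduct_of_le (h : IsCPOC D) {u a : C} (hu : D.le u a) :
    pseudoProduct h (D.dom u) a = u := by
  have hc : D.codObj (D.dom u) = D.domObj u := D.codObj_obj (D.domObj u)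
  have hle : projLE D.times (D.domObj u) (D.domObj a) :=
    (h.le_iff _ _).1 (h.ordered.O1_dom _ _ hu)
  rw [h.pseudoProduct_eq (h.friendly_self (D.domObj u)) (h.ordered.refl _) hu
    (by rw [hc, h.strong.times_eq_of_le hle]) (by rw [hc, h.strong.star_eq_of_le hle])
    (D.cod_dom u) rfl]
  refine D.comp_eq_right _ ((D.comp_eq_right _ ?_).trans (h.evaluation.E1_pair _ _))
  exact (h.evaluation.dom_pair (h.friendly_self (D.domObj u))).symm

/-- Right restriction is right multiplication by a projection. -/
theorem pseudoProduct_cod_of_le (h : IsCPOC D) {u a : C} (hu : D.le u a) :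
    pseudoProduct h a (D.cod u) = u := by
  have hc : D.domObj (D.cod u) = D.codObj u := D.domObj_obj (D.codObj u)
  have hle : projLE D.times (D.codObj u) (D.codObj a) :=
    (h.le_iff _ _).1 (h.ordered.O1_cod _ _ hu)
  rw [h.pseudoProduct_eq (h.friendly_self (D.codObj u)) hu (h.ordered.refl _)
    (by rw [hc, ← (show D.codObj u = _ from hle)]) (by rw [hc, h.strong.star_eq_of_le' hle])
    rfl (D.dom_cod u).symm]
  have h1 := D.comp_eq_left (a := u)
    (h := (h.evaluation.dom_pair (h.friendly_self (D.codObj u))).symm) (h.evaluation.E1_pair (D.codObj u) (h.friendly_self _))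
  exact (D.comp_eq_left _ (congrArg D.cod h1).symm).trans h1

/-- Restrictions of an object are objects, so at an object Θ and Δ reduce to ⋆ and ×. -/
theorem Theta_obj (h : IsCPOC D) (p x : D.Obj) : h.Theta p x = D.star x p := by
  have h1 := h.ordered.dom_eq_self (h.ordered.lres_le _ _ (h.star_dom_le x (p : C)))
  refine Subtype.ext ?_
  change D.cod (h.ordered.lres _ _ _) = _
  rw [← h1, D.cod_dom, h.ordered.dom_lres, D.domObj_obj]

theorem Delta_obj (h : IsCPOC D) (p x : D.Obj) : h.Delta p x = D.times p x := by
  have h1 := h.ordered.dom_eq_self (h.ordered.rres_le _ _ (h.cod_times_le (p : C) x))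
  refine Subtype.ext ?_
  change D.dom (h.ordered.rres _ _ _) = _
  -- The restriction is an object, hence equals its own range, which is known.
  rw [h1, ← (congrArg D.cod h1).symm.trans ((D.cod_dom _).trans h1), h.ordered.cod_rres,
    D.codObj_obj]

/-! ### Associativity of the pseudo-product. -/

theorem linked (h : IsCPOC D) (a b c : C) : h.Linked b
    (D.times (D.codObj a) (h.Delta b (D.domObj c)))
    (D.star (h.Theta b (D.codObj a)) (D.domObj c)) := by
  constructor
  · rw [← h.times_Theta]
    exact (h.strong.friendly_times_star _ _).2
  · rw [← h.star_Delta]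
    exact (h.strong.friendly_times_star _ _).1

theorem dom_lam (h : IsCPOC D) {b : C} {e f : D.Obj} (l : h.Linked b e f) :
    D.dom (h.lam h.evaluation l) = e :=
  (D.dom_comp _ _ _).trans ((D.dom_comp _ _ _).trans (h.evaluation.dom_pair _))

theorem cod_lam (h : IsCPOC D) {b : C} {e f : D.Obj} (l : h.Linked b e f) :
    D.cod (h.lam h.evaluation l) = f :=
  (D.cod_comp _ _ _).trans (h.evaluation.cod_pair l.friendly_f₁)

/-- The required right restriction of a • b has range eΘ_b = r(a)Θ_b × d(c). It is found by
restricting the three factors of a • b separately, and composing with ε(eΘ_b, f) completes λ. -/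
theorem pseudoProduct_pseudoProduct_left (h : IsCPOC D) {a b c u v : C} {e f : D.Obj}
    (l : h.Linked b e f) (he : e = D.times (D.codObj a) (h.Delta b (D.domObj c)))
    (hf : f = D.star (h.Theta b (D.codObj a)) (D.domObj c))
    (hu : D.le u a) (hv : D.le v c) (hue : D.cod u = e) (hvf : D.dom v = f) :
    pseudoProduct h (pseudoProduct h a b) c =
      D.comp (D.comp u (h.lam h.evaluation l) (hue.trans (h.dom_lam l).symm)) v
        ((D.cod_comp _ _ _).trans ((h.cod_lam l).trans hvf.symm)) := by
  have hw : h.Delta b (D.domObj c) = D.times (D.domObj b) (h.Delta b (D.domObj c)) :=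
    h.Delta_le _ _
  have hΘ : h.Theta b e = D.times (h.Theta b (D.codObj a)) (D.domObj c) := by
    rw [h.times_Theta, he]
  have hea : projLE D.times e (D.codObj a) := he ▸ h.strong.times_le _ _
  have hep : projLE D.times e (D.times (D.codObj a) (D.domObj b)) := by
    rw [he, hw, h.strong.L3]
    exact h.strong.times_le _ _
  -- This makes (e, e ⋆ d(b)) the restriction to e of the path in a • b, as monotonicity of ε
  -- requires.
  have hst : D.star e (D.domObj b) = D.star e (D.star (D.codObj a) (D.domObj b)) := by
    have := h.strong.R3 (D.domObj b) (D.codObj a) e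
    rwa [h.strong.star_eq_of_le hea] at this
  have hx : D.le (D.comp
      (D.comp u (D.eval (PPath.pair e (D.star e (D.domObj b)) l.friendly_e₁))
        (hue.trans (h.evaluation.dom_pair _).symm))
      (h.ordered.lres (D.star e (D.domObj b)) b (h.star_dom_le e b))
      ((D.cod_comp _ _ _).trans
        ((h.evaluation.cod_pair _).trans (h.ordered.dom_lres _ _ _).symm)))
      (pseudoProduct h a b) := by
    refine h.ordered.O2 _ _ _ _ _ _ (h.ordered.O2 _ _ _ _ _ _ ?_ ?_) ?_
    · refine h.ordered.le_of_cod_le hu (h.ordered.rres_le _ _ _) ?_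
      rw [h.ordered.cod_rres, hue]
      exact (h.le_iff _ _).2 hep
    · exact h.evaluation.E4 _ _ ⟨e, hep, rfl, congrArg (fun x => [x]) hst⟩
    · refine h.ordered.le_of_cod_le (h.ordered.lres_le _ _ _) (h.ordered.lres_le _ _ _) ?_
      refine (h.le_iff (h.Theta b e) (h.Theta b (D.codObj a))).2 ?_
      rw [hΘ]
      exact h.strong.times_le _ _
  rw [h.pseudoProduct_eq l.friendly_f₁ hx hv
    (by rw [codObj_pseudoProduct, hΘ]) (by rw [codObj_pseudoProduct, hf])
    (D.cod_comp _ _ _) hvf]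
  refine D.comp_congr ?_ rfl _ _
  refine (D.comp_congr (D.assoc _ _ _ _ _) rfl _ _).trans (D.assoc _ _ _ _ _)

/-- Restricting b • c factor by factor gives ρ in the middle, which `G2` exchanges for λ. -/
theorem pseudoProduct_pseudoProduct_right (h : IsCPOC D) {a b c u v : C} {e f : D.Obj}
    (l : h.Linked b e f) (he : e = D.times (D.codObj a) (h.Delta b (D.domObj c)))
    (hf : f = D.star (h.Theta b (D.codObj a)) (D.domObj c))
    (hu : D.le u a) (hv : D.le v c) (hue : D.cod u = e) (hvf : D.dom v = f) :
    pseudoProduct h a (pseudoProduct h b c) =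
      D.comp (D.comp u (h.lam h.evaluation l) (hue.trans (h.dom_lam l).symm)) v
        ((D.cod_comp _ _ _).trans ((h.cod_lam l).trans hvf.symm)) := by
  have hΔ : h.Delta b f = D.star (D.codObj a) (h.Delta b (D.domObj c)) := by
    rw [h.star_Delta, hf]
  have htb : projLE D.times (h.Theta b (D.codObj a)) (D.codObj b) := h.Theta_le _ _
  have hf' : f = D.star (h.Theta b (D.codObj a)) (D.star (D.codObj b) (D.domObj c)) := by
    have := h.strong.R3 (D.domObj c) (D.codObj b) (h.Theta b (D.codObj a))
    rw [h.strong.star_eq_of_le htb] at this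
    exact hf.trans this
  -- The path order is defined by left restriction only, so the path ending at the prescribed f must
  -- be shown to be a left restriction of the one in b • c. This is what `SP2` provides.
  have hst : f = D.star (D.times (D.codObj b) f) (D.star (D.codObj b) (D.domObj c)) := by
    have h1 := h.strong.SP2 (D.domObj c) (D.codObj b) (h.Theta b (D.codObj a))
    have h2 := h.strong.R3 (D.domObj c) (D.codObj b) (D.times (D.codObj b) f)
    rw [h.strong.star_eq_of_le (h.strong.times_le _ _)] at h2
    rw [← hf', h2] at h1
    exact h1.symm
  -- Compared through domains, where fΔ_b = r(a) ⋆ d(c)Δ_b ≤ d(c)Δ_b; the inequality of ranges `hr`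
  -- is then a consequence.
  have hy : D.le (h.ordered.rres b (D.times (D.codObj b) f) (h.cod_times_le b f))
      (h.ordered.rres b (D.times (D.codObj b) (D.domObj c)) (h.cod_times_le b (D.domObj c))) := by
    refine h.ordered.le_of_dom_le (h.ordered.rres_le _ _ _) (h.ordered.rres_le _ _ _) ?_
    refine (h.le_iff (h.Delta b f) (h.Delta b (D.domObj c))).2 ?_
    rw [hΔ]
    exact h.strong.star_le _ _
  have hr : projLE D.times (D.times (D.codObj b) f) (D.times (D.codObj b) (D.domObj c)) := by
    have := h.ordered.O1_cod _ _ hy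
    rw [h.ordered.cod_rres, h.ordered.cod_rres] at this
    exact (h.le_iff _ _).1 this
  have hx : D.le (D.comp
      (D.comp (h.ordered.rres b (D.times (D.codObj b) f) (h.cod_times_le b f))
        (D.eval (PPath.pair (D.times (D.codObj b) f) f l.friendly_f₂))
        ((h.ordered.cod_rres _ _ _).trans (h.evaluation.dom_pair _).symm))
      v ((D.cod_comp _ _ _).trans ((h.evaluation.cod_pair _).trans hvf.symm)))
      (pseudoProduct h b c) := by
    refine h.ordered.O2 _ _ _ _ _ _ (h.ordered.O2 _ _ _ _ _ _ hy ?_) ?_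
    · exact h.evaluation.E4 _ _ ⟨_, hr, rfl, congrArg (fun x => [x]) hst⟩
    · refine h.ordered.le_of_dom_le hv (h.ordered.lres_le _ _ _) ?_
      rw [h.ordered.dom_lres, hvf]
      refine (h.le_iff _ _).2 ?_
      rw [hst]
      exact h.strong.star_le _ _
  rw [h.pseudoProduct_eq l.friendly_e₂ hu hx
    (by rw [domObj_pseudoProduct, he]) (by rw [domObj_pseudoProduct, hΔ])
    hue ((D.dom_comp _ _ _).trans (D.dom_comp _ _ _))]
  have hG : D.cod u = D.dom (h.rho h.evaluation l) := by
    rw [← h.G2 _ _ _ l, h.dom_lam, hue]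
  refine (D.comp_comp_comp_comp _ (h.evaluation.cod_pair l.friendly_e₂) _ _ _ _ hG ?_).trans
    (D.comp_congr (D.comp_congr rfl (h.G2 _ _ _ l).symm _ _) rfl _ _)
  exact (D.cod_comp _ _ _).trans
    ((congrArg D.cod (h.G2 _ _ _ l).symm).trans ((h.cod_lam l).trans hvf.symm))

theorem pseudoProduct_assoc (h : IsCPOC D) (a b c : C) :
    pseudoProduct h (pseudoProduct h a b) c = pseudoProduct h a (pseudoProduct h b c) := by
  have hu := h.cod_times_le a (h.Delta b (D.domObj c))
  have hv := h.star_dom_le (h.Theta b (D.codObj a)) c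
  rw [h.pseudoProduct_pseudoProduct_left (h.linked a b c) rfl rfl (h.ordered.rres_le _ _ hu)
      (h.ordered.lres_le _ _ hv) (h.ordered.cod_rres _ _ _) (h.ordered.dom_lres _ _ _),
    h.pseudoProduct_pseudoProduct_right (h.linked a b c) rfl rfl (h.ordered.rres_le _ _ hu)
      (h.ordered.lres_le _ _ hv) (h.ordered.cod_rres _ _ _) (h.ordered.dom_lres _ _ _)]

/-! ### The DRC-restriction axioms for the pseudo-product. -/

theorem obj_pseudoProduct_of_le (h : IsCPOC D) {g p : D.Obj} (hg : D.le g p) :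
    pseudoProduct h g p = g := by
  have := h.dom_pseudoProduct_of_le hg
  rwa [D.dom_obj] at this

theorem pseudoProduct_obj_of_le (h : IsCPOC D) {g p : D.Obj} (hg : D.le g p) :
    pseudoProduct h p g = g := by
  have := h.pseudoProduct_cod_of_le hg
  rwa [D.cod_obj] at this

theorem pseudoProduct_obj_mul_obj (h : IsCPOC D) {g p : D.Obj} (hg : D.le g p) :
    pseudoProduct h (pseudoProduct h p g) p = g := by
  rw [h.pseudoProduct_obj_of_le hg, h.obj_pseudoProduct_of_le hg]

theorem isDRCSemigroup (h : IsCPOC D) : @IsDRCSemigroup C (sData h) :=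
  @IsDRCSemigroup.mk C (sData h)
    h.pseudoProduct_assoc
    (fun x => h.dom_pseudoProduct_of_le (h.ordered.refl x))
    (fun x => h.pseudoProduct_cod_of_le (h.ordered.refl x))
    (fun x y => by
      change D.dom (pseudoProduct h x y) = D.dom (pseudoProduct h x (D.dom y))
      rw [h.dom_pseudoProduct, h.dom_pseudoProduct]
      exact congrArg (fun p => (h.Delta x p).1) (D.domObj_obj (D.domObj y)).symm)
    (fun x y => by
      change D.cod (pseudoProduct h x y) = D.cod (pseudoProduct h (D.cod x) y)
      rw [h.cod_pseudoProduct, h.cod_pseudoProduct]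
      exact congrArg (fun p => (h.Theta y p).1) (D.codObj_obj (D.codObj x)).symm)
    (fun x y => (h.pseudoProduct_obj_mul_obj (g := D.domObj (pseudoProduct h x y))
      (p := D.domObj x) (h.dom_pseudoProduct_le x y)).symm)
    (fun x y => (h.pseudoProduct_obj_mul_obj (g := D.codObj (pseudoProduct h x y))
      (p := D.codObj y) (h.cod_pseudoProduct_le x y)).symm)
    (fun x => D.dom_obj (D.domObj x))
    (fun x => D.cod_obj (D.codObj x))
    (fun x => D.cod_obj (D.domObj x))
    (fun x => D.dom_obj (D.codObj x))

/-- Each ample condition describes one restriction of x twice: as x multiplied by the range of the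
restriction, and as x multiplied by its domain. -/
theorem isDRCRestriction (h : IsCPOC D) : @IsDRCRestriction C (sData h) := by
  refine @IsDRCRestriction.mk C (sData h) h.isDRCSemigroup (fun x y => ?_) (fun x y => ?_)
  · change pseudoProduct h x (D.cod (pseudoProduct h y x)) =
      pseudoProduct h (D.cod (pseudoProduct h y (D.dom x))) x
    have hu := h.ordered.lres_le _ _ (h.star_dom_le (D.codObj y) x)
    have h1 : D.cod (pseudoProduct h y (D.dom x)) =
        D.dom (h.ordered.lres _ _ (h.star_dom_le (D.codObj y) x)) := by
      rw [h.ordered.dom_lres, h.cod_pseudoProduct]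
      exact congrArg Subtype.val (h.Theta_obj (D.domObj x) (D.codObj y))
    have h2 : D.cod (pseudoProduct h y x) =
        D.cod (h.ordered.lres _ _ (h.star_dom_le (D.codObj y) x)) := h.cod_pseudoProduct y x
    rw [h1, h2, h.dom_pseudoProduct_of_le hu, h.pseudoProduct_cod_of_le hu]
  · change pseudoProduct h (D.dom (pseudoProduct h x y)) x =
      pseudoProduct h x (D.dom (pseudoProduct h (D.cod x) y))
    have hu := h.ordered.rres_le _ _ (h.cod_times_le x (D.domObj y))
    have h1 : D.dom (pseudoProduct h (D.cod x) y) =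
        D.cod (h.ordered.rres _ _ (h.cod_times_le x (D.domObj y))) := by
      rw [h.ordered.cod_rres, h.dom_pseudoProduct]
      exact congrArg Subtype.val (h.Delta_obj (D.codObj x) (D.domObj y))
    have h2 : D.dom (pseudoProduct h x y) =
        D.dom (h.ordered.rres _ _ (h.cod_times_le x (D.domObj y))) := h.dom_pseudoProduct x y
    rw [h1, h2, h.dom_pseudoProduct_of_le hu, h.pseudoProduct_cod_of_le hu]

/-- A functor sends restrictions to arrows below the images with the correct end objects, so the
image of the factorization of a • b computes φ(a) • φ(b). -/
theorem isBiUnaryHom (h : IsCPOC D) {C' : Type v} {D' : CPOData C'} (h' : IsCPOC D')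
    {φ : C → C'} (hφ : IsCPOFunctor D D' φ) :
    @IsBiUnaryHom C C' (sData h) (sData h') φ := by
  refine @IsBiUnaryHom.mk C C' (sData h) (sData h') φ (fun a b => ?_)
    (fun x => (hφ.F1_dom x).symm) (fun x => (hφ.F1_cod x).symm)
  change φ (pseudoProduct h a b) = pseudoProduct h' (φ a) (φ b)
  have ha : mapObj φ hφ.F1_dom (D.codObj a) = D'.codObj (φ a) :=
    Subtype.ext (hφ.F1_cod a).symm
  have hb : mapObj φ hφ.F1_dom (D.domObj b) = D'.domObj (φ b) :=
    Subtype.ext (hφ.F1_dom b).symm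
  have ht := hφ.F4_times (D.codObj a) (D.domObj b)
  have hs := hφ.F4_star (D.codObj a) (D.domObj b)
  rw [ha, hb] at ht hs
  have hfr : friendly D'.times D'.star (mapObj φ hφ.F1_dom (D.times (D.codObj a) (D.domObj b)))
      (mapObj φ hφ.F1_dom (D.star (D.codObj a) (D.domObj b))) := by
    rw [ht, hs]
    exact h'.strong.friendly_times_star _ _
  rw [h'.pseudoProduct_eq hfr (hφ.F3 _ _ (h.ordered.rres_le _ _ (h.cod_times_le a (D.domObj b))))
    (hφ.F3 _ _ (h.ordered.lres_le _ _ (h.star_dom_le (D.codObj a) b))) ht hs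
    ((hφ.F1_cod _).trans (congrArg φ (h.ordered.cod_rres _ _ _)))
    ((hφ.F1_dom _).trans (congrArg φ (h.ordered.dom_lres _ _ _)))]
  refine (hφ.F2 _ _ _).trans (D'.comp_congr ((hφ.F2 _ _ _).trans ?_) rfl _ _)
  exact D'.comp_congr rfl (hφ.F5 _) _ _

/-! ### Recovering the order and the evaluation map. -/

theorem le_iff_naturalLE (h : IsCPOC D) (a b : C) : @naturalLE C (sData h) a b ↔ D.le a b := by
  change (a = pseudoProduct h (D.dom a) b ∧
    pseudoProduct h (pseudoProduct h (D.dom b) (D.dom a)) (D.dom b) = D.dom a) ↔ _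
  constructor
  · rintro ⟨h1, h2⟩
    -- The domain of a pseudo-product lies below that of its left factor; used twice on the sandwich
    -- b⁺ • a⁺ • b⁺ = a⁺.
    have hle : D.le (D.domObj a) (D.dom b) := by
      have k1 := h.dom_pseudoProduct_le (pseudoProduct h (D.dom b) (D.dom a)) (D.dom b)
      have k2 := h.dom_pseudoProduct_le (D.dom b) (D.dom a)
      have k := h.ordered.trans _ _ _ k1 k2
      rw [h2] at k
      have e1 : D.dom (D.dom a) = D.dom a := D.dom_obj (D.domObj a)
      have e2 : D.dom (D.dom b) = D.dom b := D.dom_obj (D.domObj b)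
      rwa [e1, e2] at k
    have hu := h.ordered.lres_le _ _ hle
    have h3 := h.dom_pseudoProduct_of_le hu
    rw [h.ordered.dom_lres] at h3
    rw [h1]
    change D.le (pseudoProduct h (D.domObj a) b) b
    rwa [h3]
  · intro hab
    exact ⟨(h.dom_pseudoProduct_of_le hab).symm,
      h.pseudoProduct_obj_mul_obj (g := D.domObj a) (p := D.domObj b) (h.ordered.O1_dom _ _ hab)⟩

theorem pseudoProduct_obj (h : IsCPOC D) (a : C) (q : D.Obj)
    (hq : friendly D.times D.star (D.codObj a) q) :
    pseudoProduct h a q = D.comp a (D.eval (PPath.pair (D.codObj a) q hq))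
      (h.evaluation.dom_pair hq).symm := by
  rw [h.pseudoProduct_eq hq (h.ordered.refl a) (h.ordered.refl _)
    (by rw [D.domObj_obj, ← hq.1]) (by rw [D.domObj_obj, ← hq.2]) rfl (D.dom_obj q)]
  exact D.comp_eq_left _ ((D.cod_comp _ _ _).trans (h.evaluation.cod_pair hq)).symm

/-- Starting from an arbitrary evaluated path lets each further factor be absorbed as a two-term
path by `E3`. -/
theorem foldl_pseudoProduct (h : IsCPOC D) (p : PPath D.times D.star) (l : List D.Obj)
    (hl : List.IsChain (friendly D.times D.star) (p.last :: l)) :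
    l.foldl (fun x q => pseudoProduct h x q.1) (D.eval p) =
      D.eval (p.comp ⟨p.last, l, hl⟩ rfl) := by
  induction l generalizing p with
  | nil => exact congrArg D.eval (PPath.ext rfl (List.append_nil _).symm)
  | cons q l ih =>
    obtain ⟨h1, h2⟩ := List.isChain_cons_cons.1 hl
    have hc : D.codObj (D.eval p) = p.last := Subtype.ext (h.evaluation.E2_cod p)
    have h3 : pseudoProduct h (D.eval p) q.1 = D.eval (p.comp (PPath.pair p.last q h1) rfl) := by
      refine (h.pseudoProduct_obj _ q (by rwa [hc])).trans
        (Eq.trans ?_ (h.evaluation.E3 _ _ _).symm)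
      refine D.comp_congr rfl ?_ _ _
      exact congrArg D.eval (PPath.ext hc rfl)
    have h4 : (p.comp (PPath.pair p.last q h1) rfl).last = q := by
      simp [PPath.last, PPath.comp, PPath.pair]
    rw [List.foldl_cons, h3, ih _ (by rwa [h4])]
    exact congrArg D.eval (PPath.ext rfl (List.append_assoc _ _ _))

theorem eval_eq_foldl (h : IsCPOC D) (p : PPath D.times D.star) :
    p.tail.foldl (fun x q => pseudoProduct h x q.1) p.head.1 = D.eval p := by
  have := h.foldl_pseudoProduct (PPath.single p.head) p.tail p.chain
  rw [h.evaluation.E1_single] at this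
  exact this

end IsCPOC

/-! ### The two constructions are mutually inverse -/

/-- Objects depend on d, and paths on × and ⋆; comparing underlying elements avoids transport
between these types. -/
theorem CPOData.ext_of_val {C : Type u} {D₁ D₂ : CPOData C} (hdom : D₁.dom = D₂.dom)
    (hcod : D₁.cod = D₂.cod) (hcomp : ∀ a b h₁ h₂, D₁.comp a b h₁ = D₂.comp a b h₂)
    (hle : ∀ a b, D₁.le a b ↔ D₂.le a b)
    (htimes : ∀ (e f : D₁.Obj) (e' f' : D₂.Obj), e.1 = e'.1 → f.1 = f'.1 →
      (D₁.times e f).1 = (D₂.times e' f').1)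
    (hstar : ∀ (e f : D₁.Obj) (e' f' : D₂.Obj), e.1 = e'.1 → f.1 = f'.1 →
      (D₁.star e f).1 = (D₂.star e' f').1)
    (heval : ∀ (p : PPath D₁.times D₁.star) (q : PPath D₂.times D₂.star), p.head.1 = q.head.1 →
      p.tail.map Subtype.val = q.tail.map Subtype.val → D₁.eval p = D₂.eval q) : D₁ = D₂ := by
  obtain ⟨⟨dom, cod, comp, _, _, _, _, _, _, _⟩, le, times, star, eval⟩ := D₁
  obtain ⟨⟨dom', cod', comp', _, _, _, _, _, _, _⟩, le', times', star', eval'⟩ := D₂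
  dsimp only at hdom hcod hcomp hle
  subst hdom hcod
  obtain rfl : comp = comp' := funext fun a => funext fun b => funext fun h => hcomp a b h h
  obtain rfl : le = le' := funext fun a => funext fun b => propext (hle a b)
  obtain rfl : times = times' :=
    funext fun e => funext fun f => Subtype.ext (htimes e f e f rfl rfl)
  obtain rfl : star = star' :=
    funext fun e => funext fun f => Subtype.ext (hstar e f e f rfl rfl)
  obtain rfl : eval = eval' := funext fun p => heval p p rfl rfl
  rfl

theorem cData_sData {C : Type u} {D : CPOData C} (h : IsCPOC D)
    (hS : @IsDRCRestriction C (sData h)) : @cData C (sData h) hS = D := by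
  refine CPOData.ext_of_val rfl rfl (fun a b _ hab => (h.comp_eq_pseudoProduct a b hab).symm)
    h.le_iff_naturalLE ?_ ?_ ?_
  · rintro ⟨e, he⟩ ⟨f, hf⟩ ⟨_, he'⟩ ⟨_, hf'⟩ rfl rfl
    refine (h.dom_pseudoProduct _ _).trans ?_
    have := h.Delta_obj ⟨e, he'⟩ ⟨f, hf'⟩
    refine (congrArg (fun q => (h.Delta e q).1) (D.domObj_obj ⟨f, hf'⟩)).trans ?_
    exact congrArg Subtype.val this
  · rintro ⟨e, he⟩ ⟨f, hf⟩ ⟨_, he'⟩ ⟨_, hf'⟩ rfl rfl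
    refine (h.cod_pseudoProduct _ _).trans ?_
    have := h.Theta_obj ⟨f, hf'⟩ ⟨e, he'⟩
    refine (congrArg (fun q => (h.Theta f q).1) (D.codObj_obj ⟨e, he'⟩)).trans ?_
    exact congrArg Subtype.val this
  · intro p q hpq hl
    rw [← h.eval_eq_foldl q]
    have h1 := List.foldl_map (f := Subtype.val) (g := pseudoProduct h) (l := q.tail)
      (init := q.head.1)
    have h2 := List.foldl_map (f := Subtype.val) (g := pseudoProduct h) (l := p.tail)
      (init := p.head.1)
    refine h2.symm.trans (Eq.trans ?_ h1)
    rw [hpq, hl]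

theorem sData_cData {S : Type u} [op : BiUnary S] (hS : IsDRCRestriction S)
    (h : IsCPOC (cData hS)) : sData h = op := by
  have h1 : pseudoProduct h = fun a b => a * b :=
    funext fun a => funext fun b => hS.pseudoProduct_eq h a b
  unfold sData
  rw [h1]
  rfl

/-- Equality of functors compares morphisms between equal but not identical objects; only the common
underlying map matters. -/
theorem DRS.hom_heq {S T : Type u} {nS : Nonempty S} {nT : Nonempty T} {op₁ op₂ : BiUnary S}
    {op₁' op₂' : BiUnary T} (h : op₁ = op₂) (h' : op₁' = op₂') {i₁ i₂ j₁ j₂} {φ : S → T}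
    {k₁ k₂} : HEq (DRS.Hom.mk (S := ⟨S, nS, op₁, i₁⟩) (T := ⟨T, nT, op₁', j₁⟩) φ k₁)
      (DRS.Hom.mk (S := ⟨S, nS, op₂, i₂⟩) (T := ⟨T, nT, op₂', j₂⟩) φ k₂) := by
  subst h h'
  rfl

theorem CPOC.hom_heq {C C' : Type u} {nC : Nonempty C} {nC' : Nonempty C'} {D₁ D₂ : CPOData C}
    {D₁' D₂' : CPOData C'} (h : D₁ = D₂) (h' : D₁' = D₂') {i₁ i₂ j₁ j₂} {φ : C → C'}
    {k₁ k₂} : HEq (CPOC.Hom.mk (C₁ := ⟨C, nC, D₁, i₁⟩) (C₂ := ⟨C', nC', D₁', j₁⟩) φ k₁)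
      (CPOC.Hom.mk (C₁ := ⟨C, nC, D₂, i₂⟩) (C₂ := ⟨C', nC', D₂', j₂⟩) φ k₂) := by
  subst h h'
  rfl

theorem DRS.mk_eq {S : Type u} {n : Nonempty S} {op₁ op₂ : BiUnary S} (h : op₁ = op₂) {i₁ i₂} :
    DRS.mk S n op₁ i₁ = DRS.mk S n op₂ i₂ := by
  subst h
  rfl

theorem CPOC.mk_eq {C : Type u} {n : Nonempty C} {D₁ D₂ : CPOData C} (h : D₁ = D₂) {i₁ i₂} :
    CPOC.mk C n D₁ i₁ = CPOC.mk C n D₂ i₂ := by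
  subst h
  rfl

end DRC

theorem theorem6p8 :
    ∃ (hCobj : ∀ S : DRC.DRS.{u}, DRC.IsCPOC (DRC.cData S.isDRCRestriction))
      (hCmap : ∀ (S T : DRC.DRS.{u}) (f : S ⟶ T), DRC.IsCPOFunctor
        (DRC.cData S.isDRCRestriction) (DRC.cData T.isDRCRestriction) f.toFun)
      (hSobj : ∀ C : DRC.CPOC.{u},
        @DRC.IsDRCRestriction C.carrier (DRC.sData C.isCPOC))
      (hSmap : ∀ (C₁ C₂ : DRC.CPOC.{u}) (f : C₁ ⟶ C₂),
        @DRC.IsBiUnaryHom C₁.carrier C₂.carrier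
          (DRC.sData C₁.isCPOC) (DRC.sData C₂.isCPOC) f.toFun),
      DRC.functorC hCobj hCmap ⋙ DRC.functorS hSobj hSmap = 𝟭 DRC.DRS.{u} ∧
      DRC.functorS hSobj hSmap ⋙ DRC.functorC hCobj hCmap = 𝟭 DRC.CPOC.{u} := by
  refine ⟨fun S => S.isDRCRestriction.isCPOC,
    fun S T f => S.isDRCRestriction.isCPOFunctor T.isDRCRestriction f.isHom,
    fun C => C.isCPOC.isDRCRestriction,
    fun C₁ C₂ f => C₁.isCPOC.isBiUnaryHom C₂.isCPOC f.isFunctor, ?_, ?_⟩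
  · refine Functor.hext (fun S => ?_) (fun S T f => ?_)
    · exact DRC.DRS.mk_eq (DRC.sData_cData S.isDRCRestriction _)
    · exact DRC.DRS.hom_heq (DRC.sData_cData S.isDRCRestriction _)
        (DRC.sData_cData T.isDRCRestriction _)
  · refine Functor.hext (fun C => ?_) (fun C₁ C₂ f => ?_)
    · exact DRC.CPOC.mk_eq (DRC.cData_sData C.isCPOC _)
    · exact DRC.CPOC.hom_heq (DRC.cData_sData C₁.isCPOC _) (DRC.cData_sData C₂.isCPOC _)
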